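/- Let $-\infty\le A,B\le\infty$, let $f:(A,B)\to[0,\infty]$ be lower semicontinuous, and suppose that the graph domain $$D=\{(x,y): A<x<B,\ 0<y<f(x)\}$$ is simply connected (in particular nonempty and connected) and has finite area. Let $\varphi:\mathbb D\to D$ be a conformal bijection of the unit disk onto $D$; through $\varphi$ the prime ends of $D$ are identified with the points of the unit circle $\mathbb S^1$. Let $a,b,c,d\in\mathbb S^1$ be four distinct points (prime ends of $D$) in counterclockwise order, and let $(a,b)$ and $(c,d)$ be the open counterclockwise arcs from $a$ to $b$ and from $c$ to $d$. Let $\Gamma$ be the family of all locally rectifiable curves $\gamma$ in $D$ that connect $(a,b)$ to $(c,d)$, i.e. such that $(a,b)\cup\varphi^{-1}(\gamma)\cup(c,d)$ is a connected subset of the plane. For $\varepsilon>0$ put $T_\varepsilon(x,y)=(x,\varepsilon y)$ and $\Gamma^\varepsilon=T_\varepsilon(\Gamma)$, and let $\Gamma_v\subset\Gamma$ be the (possibly empty) subfamily of vertical line segments, possibly unbounded, traversed once. For a family $\Gamma'$ of locally rectifiable curves, $$\mathrm{mod}(\Gamma')=\inf_\rho\int_{\mathbb C}\rho^2\,dx\,dy,$$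 the infimum being over Borel functions $\rho:\mathbb C\to[0,\infty]$ with $\int_\gamma\rho\,|dz|\ge1$ for every $\gamma\in\Gamma'$. Then the set of $x$-coordinates of the segments in $\Gamma_v$ is a bounded interval, possibly empty: there are real $p\le q$ such that it contains $(p,q)$ and is contained in $[p,q]$. Moreover $\mathrm{mod}(\Gamma_v)<\infty$ and $$\lim_{\varepsilon\to0^+}\varepsilon\cdot\mathrm{mod}(\Gamma^\varepsilon)=\mathrm{mod}(\Gamma_v)=\int_p^q\frac{dx}{f(x)}.$$ -/

import Mathlib

open Set Filter Topology MeasureTheory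
open scoped ENNReal

noncomputable section

/-- A locally rectifiable curve in the plane: a continuous map defined on an interval of any kind
(open, closed, half-open, bounded or not) whose variation is finite between any two parameters.
Values of `toFun` outside `dom` play no role. -/
structure PlaneCurve where
  dom : Set ℝ
  toFun : ℝ → ℂ
  ordConnected : dom.OrdConnected
  continuousOn : ContinuousOn toFun dom
  locallyRectifiable : LocallyBoundedVariationOn toFun dom

namespace PlaneCurve

/-- The set of points of a curve. -/
def trace (γ : PlaneCurve) : Set ℂ := γ.toFun '' γ.dom

/-- The line integral `∫_γ ρ |dz|`: the supremum, over the closed subcurves of `γ` between two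
parameters `s` and `t`, of the integral of `ρ` along the parametrization by arc length (the arc
length being counted from the parameter `s`). For `t < s` the range of integration is empty. -/
def lineIntegral (γ : PlaneCurve) (ρ : ℂ → ℝ≥0∞) : ℝ≥0∞ :=
  ⨆ (s ∈ γ.dom) (t ∈ γ.dom),
    ∫⁻ l in Icc 0 (variationOnFromTo γ.toFun γ.dom s t),
      ρ (naturalParameterization γ.toFun γ.dom s l)

/-- The image of a curve under a real-linear map of the plane. -/
def map (T : ℂ →L[ℝ] ℂ) (γ : PlaneCurve) : PlaneCurve where
  dom := γ.dom
  toFun := fun t => T (γ.toFun t)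
  ordConnected := γ.ordConnected
  continuousOn := T.continuous.comp_continuousOn γ.continuousOn
  locallyRectifiable :=
    T.lipschitz.comp_locallyBoundedVariationOn γ.locallyRectifiable

end PlaneCurve

/-- `ρ` is an admissible metric for the family `Γ`. -/
def IsAdmissible (Γ : Set PlaneCurve) (ρ : ℂ → ℝ≥0∞) : Prop :=
  Measurable ρ ∧ ∀ γ ∈ Γ, 1 ≤ γ.lineIntegral ρ

/-- The conformal modulus of a family of curves. -/
def curveModulus (Γ : Set PlaneCurve) : ℝ≥0∞ :=
  ⨅ (ρ : ℂ → ℝ≥0∞) (_ : IsAdmissible Γ ρ), ∫⁻ z, ρ z ^ 2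

/-- The domain under the graph of `f : (A, B) → [0, ∞]`. -/
def graphDomain (A B : EReal) (f : ℝ → ℝ≥0∞) : Set ℂ :=
  {z | A < (z.re : EReal) ∧ (z.re : EReal) < B ∧ 0 < z.im ∧ ENNReal.ofReal z.im < f z.re}

/-- `T_ε (x, y) = (x, ε y)`. -/
def verticalScaling (ε : ℝ) : ℂ →L[ℝ] ℂ :=
  Complex.reCLM.smulRight (1 : ℂ) + Complex.imCLM.smulRight ((ε : ℂ) * Complex.I)

theorem verticalScaling_apply (ε : ℝ) (z : ℂ) :
    verticalScaling ε z = ⟨z.re, ε * z.im⟩ := by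
  apply Complex.ext <;> simp [verticalScaling, mul_comm]

/-- `φ` is a conformal map of the open unit disk onto `D`. It identifies the points of the unit
circle with the prime ends of `D`. -/
def IsRiemannMap (φ : ℂ → ℂ) (D : Set ℂ) : Prop :=
  DifferentiableOn ℂ φ (Metric.ball 0 1) ∧ BijOn φ (Metric.ball 0 1) D

/-- The open arc of the unit circle traversed counterclockwise from `e^{iα}` to `e^{iβ}`
(used for `α < β < α + 2π`). -/
def openArc (α β : ℝ) : Set ℂ := (fun θ : ℝ => Complex.exp (θ * Complex.I)) '' Ioo α β

/-- The locally rectifiable curves in `D` which, in the disk model of `D` given by the conformal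
map `φ` of the unit disk onto `D`, connect the arc `P` of the unit circle to the arc `Q`: the
union of `P`, of the curve and of `Q` is a connected set. -/
def connectingCurves (φ : ℂ → ℂ) (D P Q : Set ℂ) : Set PlaneCurve :=
  {γ | γ.trace ⊆ D ∧ IsConnected (P ∪ (Metric.ball 0 1 ∩ φ ⁻¹' γ.trace) ∪ Q)}

/-- The vertical line segments, traversed once, of a family of curves. -/
def verticalSegments (Γ : Set PlaneCurve) : Set PlaneCurve :=
  {γ ∈ Γ | InjOn γ.toFun γ.dom ∧ ∃ x : ℝ, ∀ z ∈ γ.trace, z.re = x}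

/-- The set of the `x`-coordinates of the points of the curves of a family. -/
def xCoordinates (Γ : Set PlaneCurve) : Set ℝ :=
  {x | ∃ γ ∈ Γ, ∃ z ∈ γ.trace, z.re = x}

end

/-! Write `ψ` for the inverse of `φ` and `F` for `f` extended by `0` to the line. Boundary behaviour
is expressed by accumulation: a set accumulates at an arc `P` if its image under `ψ` has a limit
point in `P`. One topological fact does the work (`Accumulates.of_separates`): if two disjoint open
sets accumulate at a connected `P`, so does any set separating them in `D`. Compact subsets of `D`
never accumulate at the circle and can be dropped from separating sets.

Lower bound. The scaled family contains the slices of height `ε F(x)`, and Cauchy–Schwarz on each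
slice gives `∫ 1/F ≤ ε mod` for every `ε` (`lintegral_inv_le_curveModulus`). For the vertical
segments themselves the metric `1/F` gives equality.

Upper bound. After rescaling, a curve of horizontal extent at least `d` is handled by the metric
`ε/d` on `D`, whose energy tends to `0` because the area is finite. Only narrow curves matter. The
positions to which narrow curves can shrink lie in an interval `[p, q]` whose interior consists of
positions of vertical segments (`exists_interval`), because a vertical line between two narrow
curves separates them at both arcs. By compactness a narrow curve is either near `p`, `q` or
infinity, or well inside `(p, q)` (`exists_extent_dichotomy`). In the first case the conformal
metric `|ψ'|/δ` is used, `δ` being a lower bound for the distance of the arcs; its energy is finite,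
hence small over a small zone. In the second case the metric is `(1 + εK)/g` below the graph of a
`K`-Lipschitz minorant `g` of `F` with `∫ 1/g` close to `∫ 1/F`.

For this last metric, the curve must run from the bottom up to the graph of `g`. Since `|ψ'|` is
square integrable and the area is finite, almost every slice has an image of finite length, so
neither of its ends can accumulate at both arcs. Separation forces all these good slices to have the
same orientation (`slices_orientation`), and a curve between two of them that stayed on one side of
the graph would force an end of a good slice to the wrong arc (`exists_le_and_exists_ge_graph`). -/

/-! ### Arc length and lower bounds for line integrals. -/

theorem ContinuousOn.continuousOn_variationOnFromTo {E : Type*} [PseudoMetricSpace E]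
    {f : ℝ → E} {s : Set ℝ} (hc : ContinuousOn f s) (hf : LocallyBoundedVariationOn f s)
    {a : ℝ} (ha : a ∈ s) : ContinuousOn (variationOnFromTo f s a) s := by
  intro x hx
  have hl := variationOnFromTo.tendsto_left ha hx hf
    ((hc x hx).mono_left (nhdsWithin_mono x (inter_subset_left : s ∩ Iio x ⊆ s)))
  have hr := variationOnFromTo.tendsto_right ha hx hf
    ((hc x hx).mono_left (nhdsWithin_mono x (inter_subset_left : s ∩ Ioi x ⊆ s)))
  rw [dist_self, sub_zero] at hl
  rw [dist_self, add_zero] at hr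
  have hs : s = (s ∩ Iio x) ∪ {x} ∪ (s ∩ Ioi x) := by
    ext y
    rcases lt_trichotomy y x with h | h | h
    · simp [h, h.ne, h.le]
    · simp [h, hx]
    · simp [h, h.ne', h.le]
  unfold ContinuousWithinAt
  rw [hs, nhdsWithin_union, nhdsWithin_union, ← hs]
  refine Tendsto.sup (Tendsto.sup hl ?_) hr
  rw [nhdsWithin_singleton]
  exact tendsto_pure_nhds _ _

/-- `G` is Lipschitz with a constant arbitrarily close to `c` in small neighbourhoods of `z`. -/
def StrictLipschitzAt (G : ℂ → ℝ) (c : ℝ) (z : ℂ) : Prop :=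
  0 ≤ c ∧ ∀ η > 0, ∃ N ∈ 𝓝 z, ∀ w ∈ N, ∀ w' ∈ N, dist (G w) (G w') ≤ (c + η) * dist w w'

/-- `ρ` acts as an upper gradient of `G`. The composite `G ∘ σ` is locally Lipschitz, hence
Lipschitz on the compact interval and the integral of its derivative, which is at most `c` because
the local Lipschitz constants come arbitrarily close to `c`. -/
theorem edist_le_lintegral_of_strictLipschitzAt {σ : ℝ → ℂ} {V : ℝ} (hV : 0 ≤ V)
    (hσ : LipschitzOnWith 1 σ (Icc 0 V)) {G : ℂ → ℝ} {ρ : ℂ → ℝ≥0∞}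
    (hG : ∀ l ∈ Icc 0 V, ∃ c, ENNReal.ofReal c ≤ ρ (σ l) ∧ StrictLipschitzAt G c (σ l)) :
    edist (G (σ 0)) (G (σ V)) ≤ ∫⁻ l in Icc 0 V, ρ (σ l) := by
  have hdist : ∀ l ∈ Icc 0 V, ∀ c, StrictLipschitzAt G c (σ l) → ∀ η > 0,
      ∃ t ∈ 𝓝[Icc 0 V] l, ∀ x ∈ t, ∀ y ∈ t, dist (G (σ x)) (G (σ y)) ≤ (c + η) * dist x y := by
    intro l hl c hc η hη
    obtain ⟨N, hN, h⟩ := hc.2 η hη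
    refine ⟨σ ⁻¹' N ∩ Icc 0 V, inter_mem (hσ.continuousOn l hl hN) self_mem_nhdsWithin, ?_⟩
    intro x hx y hy
    refine (h _ hx.1 _ hy.1).trans ?_
    have := hσ.dist_le_mul x hx.2 y hy.2
    rw [NNReal.coe_one, one_mul] at this
    exact mul_le_mul_of_nonneg_left this (by linarith [hc.1])
  have hlip : LocallyLipschitzOn (Icc 0 V) (G ∘ σ) := by
    intro l hl
    obtain ⟨c, -, hc⟩ := hG l hl
    obtain ⟨t, ht, h⟩ := hdist l hl c hc 1 one_pos
    refine ⟨⟨c + 1, by linarith [hc.1]⟩, t, ht, LipschitzOnWith.of_dist_le_mul ?_⟩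
    exact fun x hx y hy => h x hx y hy
  obtain ⟨K, hK⟩ := hlip.exists_lipschitzOnWith_of_compact isCompact_Icc
  rw [← uIcc_of_le hV] at hK
  have hac := hK.absolutelyContinuousOnInterval.integral_deriv_eq_sub
  rw [edist_comm, edist_eq_enorm_sub]
  change ‖(G ∘ σ) V - (G ∘ σ) 0‖ₑ ≤ _
  -- At interior points a neighbourhood relative to `[0, V]` is a full neighbourhood, as the bound
  -- on `deriv` requires.
  rw [← hac, intervalIntegral.integral_of_le hV, integral_Ioc_eq_integral_Ioo]
  refine (enorm_integral_le_lintegral_enorm _).trans ?_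
  refine (setLIntegral_mono' measurableSet_Ioo ?_).trans
    (lintegral_mono_set Ioo_subset_Icc_self)
  intro l hl
  obtain ⟨c, hcρ, hc⟩ := hG l (Ioo_subset_Icc_self hl)
  refine le_trans ?_ hcρ
  rw [← ofReal_norm]
  refine ENNReal.ofReal_le_ofReal (le_of_forall_pos_le_add fun η hη => ?_)
  refine norm_deriv_le_of_lip' (by linarith [hc.1]) ?_
  obtain ⟨t, ht, h⟩ := hdist l (Ioo_subset_Icc_self hl) c hc η hη
  rw [nhdsWithin_eq_nhds.2 (Icc_mem_nhds hl.1 hl.2)] at ht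
  filter_upwards [ht] with x hx
  exact h x hx l (mem_of_mem_nhds ht)

theorem HasUnitSpeedOn.lipschitzOnWith {E : Type*} [PseudoEMetricSpace E] {f : ℝ → E} {s : Set ℝ}
    (h : HasUnitSpeedOn f s) : LipschitzOnWith 1 f s := by
  have key : ∀ x ∈ s, ∀ y ∈ s, x ≤ y → edist (f x) (f y) ≤ edist x y := by
    intro x hx y hy hxy
    refine (eVariationOn.edist_le f (s := s ∩ Icc x y) ⟨hx, le_rfl, hxy⟩ ⟨hy, hxy, le_rfl⟩).trans ?_
    rw [h hx hy, NNReal.coe_one, one_mul, edist_comm, edist_dist, Real.dist_eq,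
      abs_of_nonneg (sub_nonneg.2 hxy)]
  intro x hx y hy
  rw [ENNReal.coe_one, one_mul]
  rcases le_total x y with hxy | hxy
  · exact key x hx y hy hxy
  · rw [edist_comm, edist_comm x]
    exact key y hy x hx hxy

namespace PlaneCurve

variable (γ : PlaneCurve)

/-- Continuity leaves no gaps among the arc lengths; at a length that is not attained,
`naturalParameterization` would be a junk value. -/
theorem Icc_subset_image_variationOnFromTo {s t : ℝ} (hs : s ∈ γ.dom) (ht : t ∈ γ.dom)
    (hst : s ≤ t) : Icc 0 (variationOnFromTo γ.toFun γ.dom s t) ⊆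
      variationOnFromTo γ.toFun γ.dom s '' Icc s t := by
  have hsub : Icc s t ⊆ γ.dom := γ.ordConnected.out hs ht
  have := intermediate_value_Icc hst
    ((γ.continuousOn.continuousOn_variationOnFromTo γ.locallyRectifiable hs).mono hsub)
  rwa [variationOnFromTo.self] at this

theorem naturalParameterization_variationOnFromTo {s t : ℝ} (hs : s ∈ γ.dom) (ht : t ∈ γ.dom) :
    naturalParameterization γ.toFun γ.dom s (variationOnFromTo γ.toFun γ.dom s t) = γ.toFun t :=
  edist_eq_zero.1 (edist_naturalParameterization_eq_zero γ.locallyRectifiable hs ht)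

/-- This is how every metric below is shown to be admissible: it suffices to find `G` with gradient
at most `ρ` on the trace and oscillation at least, or arbitrarily close to, `1` along it. -/
theorem edist_le_lineIntegral {G : ℂ → ℝ} {ρ : ℂ → ℝ≥0∞}
    (hG : ∀ z ∈ γ.trace, ∃ c, ENNReal.ofReal c ≤ ρ z ∧ StrictLipschitzAt G c z)
    {s t : ℝ} (hs : s ∈ γ.dom) (ht : t ∈ γ.dom) :
    edist (G (γ.toFun s)) (G (γ.toFun t)) ≤ γ.lineIntegral ρ := by
  wlog hst : s ≤ t generalizing s t
  · rw [edist_comm]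
    exact this ht hs (le_of_not_ge hst)
  refine le_trans ?_ (le_iSup₂_of_le s hs (le_iSup₂_of_le t ht le_rfl))
  have hsub := γ.Icc_subset_image_variationOnFromTo hs ht hst
  have hdom : Icc s t ⊆ γ.dom := γ.ordConnected.out hs ht
  have h0 := γ.naturalParameterization_variationOnFromTo hs hs
  rw [variationOnFromTo.self] at h0
  rw [← γ.naturalParameterization_variationOnFromTo hs ht]
  conv_lhs => rw [← h0]
  refine edist_le_lintegral_of_strictLipschitzAt (variationOnFromTo.nonneg_of_le _ _ hst)
    ((has_unit_speed_naturalParameterization γ.toFun γ.locallyRectifiable hs).lipschitzOnWith.mono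
      (hsub.trans (image_mono hdom))) ?_
  intro l hl
  obtain ⟨r, hr, rfl⟩ := hsub hl
  rw [γ.naturalParameterization_variationOnFromTo hs (hdom hr)]
  exact hG _ ⟨r, hdom hr, rfl⟩

/-- The curve `t ↦ x + i ε t` defined on the set of `t > 0` with `t < h`. -/
def vertical (x ε : ℝ) (h : ℝ≥0∞) : PlaneCurve where
  dom := {t | 0 < t ∧ ENNReal.ofReal t < h}
  toFun := fun t => ⟨x, ε * t⟩
  ordConnected := ⟨fun _ hs _ ht _ hr =>
    ⟨hs.1.trans_le hr.1, (ENNReal.ofReal_le_ofReal hr.2).trans_lt ht.2⟩⟩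
  continuousOn := by
    have : (fun t : ℝ => (⟨x, ε * t⟩ : ℂ)) = fun t : ℝ => (x : ℂ) + (ε * t : ℝ) * Complex.I := by
      ext t
      apply Complex.ext <;> simp
    rw [this]
    fun_prop
  locallyRectifiable := by
    have : LipschitzWith ‖ε‖₊ (fun t : ℝ => (⟨x, ε * t⟩ : ℂ)) := by
      refine LipschitzWith.of_dist_le_mul fun s t => ?_
      rw [Complex.dist_of_re_eq (z := ⟨x, ε * s⟩) (w := ⟨x, ε * t⟩) rfl, Real.dist_eq,
        Real.dist_eq, ← mul_sub, abs_mul]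
      rfl
    exact this.locallyBoundedVariationOn _

/-- Arc length is `ε` times the parameter difference here, so the natural parametrization is a
translation in `y`. The inequality is the direction needed for lower bounds on moduli. -/
theorem lineIntegral_vertical_le (x : ℝ) {ε : ℝ} (hε : 0 < ε) (h : ℝ≥0∞) (ρ : ℂ → ℝ≥0∞) :
    (vertical x ε h).lineIntegral ρ ≤
      ∫⁻ y in {y | 0 < y ∧ ENNReal.ofReal (y / ε) < h}, ρ ⟨x, y⟩ := by
  refine iSup₂_le fun s hs => iSup₂_le fun t ht => ?_
  rcases lt_or_ge t s with hst | hst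
  · have : variationOnFromTo (vertical x ε h).toFun (vertical x ε h).dom s t ≤ 0 :=
      variationOnFromTo.nonpos_of_ge _ _ hst.le
    rcases this.lt_or_eq with h0 | h0
    · simp [Icc_eq_empty (not_le.2 h0)]
    · simp [h0]
  set γ := vertical x ε h with hγ
  have hdom : Icc s t ⊆ γ.dom := γ.ordConnected.out hs ht
  have hV : ∀ r ∈ Icc s t, variationOnFromTo γ.toFun γ.dom s r = ε * r - ε * s := by
    intro r hr
    rw [variationOnFromTo.eq_of_le _ _ hr.1]
    have : eVariationOn γ.toFun (γ.dom ∩ Icc s r) =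
        eVariationOn (fun t : ℝ => ε * t) (γ.dom ∩ Icc s r) := by
      have : ∀ a b, edist (γ.toFun a) (γ.toFun b) = edist (ε * a) (ε * b) := fun a b =>
        Complex.edist_of_re_eq (z := ⟨x, ε * a⟩) (w := ⟨x, ε * b⟩) rfl
      simp only [eVariationOn, this]
    have hm : MonotoneOn (fun t : ℝ => ε * t) γ.dom :=
      fun a _ b _ hab => mul_le_mul_of_nonneg_left hab hε.le
    rw [this, hm.eVariationOn_eq hs (hdom hr), ENNReal.toReal_ofReal]
    exact sub_nonneg.2 (hm hs (hdom hr) hr.1)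
  have hst' : ε * s ≤ ε * t := mul_le_mul_of_nonneg_left hst hε.le
  rw [hV t ⟨hst, le_rfl⟩]
  have hcongr : ∀ l ∈ Icc 0 (ε * t - ε * s),
      ρ (naturalParameterization γ.toFun γ.dom s l) = ρ ⟨x, l + ε * s⟩ := by
    intro l hl
    have hr : l / ε + s ∈ Icc s t := by
      constructor
      · have := div_nonneg hl.1 hε.le
        linarith
      · have : l / ε ≤ t - s := by
          rw [div_le_iff₀ hε]; linarith [hl.2, mul_comm (t - s) ε, mul_sub ε t s]
        linarith
    have h1 := hV _ hr
    have h2 : ε * (l / ε + s) = l + ε * s := by field_simp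
    rw [h2, add_sub_cancel_right] at h1
    rw [← h1, γ.naturalParameterization_variationOnFromTo hs (hdom hr), h1, ← h2]
    rfl
  rw [setLIntegral_congr_fun measurableSet_Icc hcongr]
  have hmp := (measurePreserving_add_right volume (ε * s)).setLIntegral_comp_preimage_emb
    (measurableEmbedding_addRight (ε * s)) (fun y => ρ ⟨x, y⟩) (Icc (ε * s) (ε * t))
  rw [preimage_add_const_Icc, sub_self] at hmp
  rw [hmp]
  refine lintegral_mono_set fun y hy => ?_
  have hr : y / ε ∈ Icc s t := by
    constructor
    · rw [le_div_iff₀ hε]; linarith [hy.1]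
    · rw [div_le_iff₀ hε]; linarith [hy.2]
  have := hdom hr
  exact ⟨(div_pos_iff_of_pos_right hε).1 this.1, this.2⟩

end PlaneCurve

/-! ### The inverse Riemann map and its finite energy. -/

open Metric

/-- The inverse of a conformal map of the unit disk. -/
noncomputable def diskInverse (φ : ℂ → ℂ) : ℂ → ℂ := Function.invFunOn φ (ball 0 1)

namespace IsRiemannMap

variable {φ : ℂ → ℂ} {D : Set ℂ}

theorem diskInverse_mem (h : IsRiemannMap φ D) {w : ℂ} (hw : w ∈ D) :
    diskInverse φ w ∈ ball (0 : ℂ) 1 := Function.invFunOn_mem (h.2.surjOn hw)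

theorem apply_diskInverse (h : IsRiemannMap φ D) {w : ℂ} (hw : w ∈ D) :
    φ (diskInverse φ w) = w := Function.invFunOn_eq (h.2.surjOn hw)

theorem diskInverse_apply (h : IsRiemannMap φ D) {z : ℂ} (hz : z ∈ ball (0 : ℂ) 1) :
    diskInverse φ (φ z) = z :=
  h.2.injOn (h.diskInverse_mem (h.2.mapsTo hz)) hz (h.apply_diskInverse (h.2.mapsTo hz))

theorem injOn_diskInverse (h : IsRiemannMap φ D) : InjOn (diskInverse φ) D := fun w hw w' hw' e => by
  rw [← h.apply_diskInverse hw, e, h.apply_diskInverse hw']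

theorem continuousOn (h : IsRiemannMap φ D) : ContinuousOn φ (ball 0 1) := h.1.continuousOn

theorem isOpen_image (h : IsRiemannMap φ D) {U : Set ℂ} (hU : U ⊆ ball 0 1) (hUo : IsOpen U) :
    IsOpen (φ '' U) := by
  refine ((h.1.analyticOnNhd isOpen_ball).is_constant_or_isOpen
    (convex_ball (0 : ℂ) 1).isPreconnected).resolve_left ?_ U hU hUo
  rintro ⟨w, hw⟩
  have h0 : (0 : ℂ) ∈ ball (0 : ℂ) 1 := by simp
  have h1 : (1 / 2 : ℂ) ∈ ball (0 : ℂ) 1 := by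
    rw [mem_ball_zero_iff]; norm_num
  have := h.2.injOn h0 h1 ((hw _ h0).trans (hw _ h1).symm)
  norm_num at this

theorem isOpen (h : IsRiemannMap φ D) : IsOpen D := by
  rw [← h.2.image_eq]
  exact h.isOpen_image subset_rfl isOpen_ball

theorem continuousAt_diskInverse (h : IsRiemannMap φ D) {w : ℂ} (hw : w ∈ D) :
    ContinuousAt (diskInverse φ) w := by
  intro V hV
  rw [mem_map]
  obtain ⟨U, hUV, hUo, hwU⟩ := _root_.mem_nhds_iff.1 hV
  have hop := h.isOpen_image (U := U ∩ ball 0 1) inter_subset_right (hUo.inter isOpen_ball)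
  refine mem_of_superset (hop.mem_nhds ⟨_, ⟨hwU, h.diskInverse_mem hw⟩, h.apply_diskInverse hw⟩) ?_
  rintro _ ⟨z, hz, rfl⟩
  rw [mem_preimage, h.diskInverse_apply hz.2]
  exact hUV hz.1

theorem differentiableAt_diskInverse_of_deriv_ne_zero (h : IsRiemannMap φ D) {w : ℂ} (hw : w ∈ D)
    (hd : deriv φ (diskInverse φ w) ≠ 0) : DifferentiableAt ℂ (diskInverse φ) w := by
  have hφ := (h.1.differentiableAt (isOpen_ball.mem_nhds (h.diskInverse_mem hw))).hasDerivAt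
  refine (hφ.of_local_left_inverse (h.continuousAt_diskInverse hw) hd ?_).differentiableAt
  filter_upwards [h.isOpen.mem_nhds hw] with y hy using h.apply_diskInverse hy

/-- Zeros of `φ'` are isolated, since otherwise `φ` would be constant near a point, against
injectivity. Away from them the inverse function rule applies; at such a zero the inverse is
continuous and the singularity is removable. -/
theorem differentiableOn_diskInverse (h : IsRiemannMap φ D) :
    DifferentiableOn ℂ (diskInverse φ) D := by
  intro w hw
  set z := diskInverse φ w with hz
  have hzb := h.diskInverse_mem hw
  have han : AnalyticAt ℂ (deriv φ) z := (h.1.analyticOnNhd isOpen_ball z hzb).deriv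
  rcases han.eventually_eq_zero_or_eventually_ne_zero with h0 | h0
  · exfalso
    obtain ⟨r, hr, hsub⟩ := Metric.mem_nhds_iff.1 (inter_mem h0 (isOpen_ball.mem_nhds hzb))
    have hmem : z + (r / 2 : ℝ) ∈ ball z r := by
      rw [mem_ball, dist_eq_norm, add_sub_cancel_left, Complex.norm_real, Real.norm_eq_abs,
        abs_of_pos (half_pos hr)]
      exact half_lt_self hr
    have hc := isOpen_ball.is_const_of_deriv_eq_zero (convex_ball z r).isPreconnected
      (h.1.mono fun y hy => (hsub hy).2) (fun y hy => (hsub hy).1) (mem_ball_self hr) hmem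
    have := h.2.injOn hzb (hsub hmem).2 hc
    rw [left_eq_add] at this
    norm_num at this
    exact hr.ne' this
  · have hpre : ∀ᶠ y in 𝓝[≠] w, deriv φ (diskInverse φ y) ≠ 0 := by
      refine Tendsto.eventually (p := fun z => deriv φ z ≠ 0) ?_ h0
      refine tendsto_nhdsWithin_of_tendsto_nhds_of_eventually_within _
        ((h.continuousAt_diskInverse hw).mono_left nhdsWithin_le_nhds) ?_
      filter_upwards [self_mem_nhdsWithin, mem_nhdsWithin_of_mem_nhds (h.isOpen.mem_nhds hw)]
        with y hy hyD
      exact fun e => hy (h.injOn_diskInverse hyD hw e)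
    obtain ⟨N, hN, hsub⟩ := mem_nhdsWithin_iff_exists_mem_nhds_inter.1 hpre
    have hdiff : DifferentiableOn ℂ (diskInverse φ) (N ∩ D) := by
      refine (Complex.differentiableOn_compl_singleton_and_continuousAt_iff
        (inter_mem hN (h.isOpen.mem_nhds hw))).1 ⟨?_, h.continuousAt_diskInverse hw⟩
      rintro y ⟨⟨hyN, hyD⟩, hyw⟩
      exact (h.differentiableAt_diskInverse_of_deriv_ne_zero hyD
        (hsub ⟨hyN, hyw⟩)).differentiableWithinAt
    exact (hdiff.differentiableAt (inter_mem hN (h.isOpen.mem_nhds hw))).differentiableWithinAt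

/-- The squared modulus of the derivative is the Jacobian of an injective map, so the integral is
the area of a subset of the disk. -/
theorem lintegral_enorm_deriv_diskInverse_sq_lt_top (h : IsRiemannMap φ D) :
    ∫⁻ z in D, ‖deriv (diskInverse φ) z‖ₑ ^ 2 < ∞ := by
  have hd : ∀ z ∈ D, HasFDerivWithinAt (diskInverse φ)
      ((ContinuousLinearMap.toSpanSingleton ℂ (deriv (diskInverse φ) z)).restrictScalars ℝ) D z := by
    intro z hz
    have := (h.differentiableOn_diskInverse.differentiableAt (h.isOpen.mem_nhds hz)).hasDerivAt
    exact (this.hasFDerivAt.restrictScalars ℝ).hasFDerivWithinAt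
  have key := lintegral_abs_det_fderiv_eq_addHaar_image volume h.isOpen.measurableSet hd
    h.injOn_diskInverse
  have hdet : ∀ z : ℂ, ENNReal.ofReal |((ContinuousLinearMap.toSpanSingleton ℂ z).restrictScalars
      ℝ).det| = ‖z‖ₑ ^ 2 := by
    intro z
    have : ((ContinuousLinearMap.toSpanSingleton ℂ z).restrictScalars ℝ).det = ‖z‖ ^ 2 := by
      simp [ContinuousLinearMap.det, LinearMap.det_restrictScalars, Algebra.norm_complex_eq,
        Complex.normSq_eq_norm_sq]
    rw [this, abs_of_nonneg (by positivity), ENNReal.ofReal_pow (norm_nonneg _), ofReal_norm]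
  simp only [hdet] at key
  rw [key]
  refine (measure_mono (t := ball 0 1) ?_).trans_lt measure_ball_lt_top
  rintro _ ⟨z, hz, rfl⟩
  exact h.diskInverse_mem hz

/-- The distance to a boundary point `ζ`, measured in the disk, is the test function for the
conformal metric. Strict differentiability of analytic functions gives the sharp local constant. -/
theorem strictLipschitzAt_dist (h : IsRiemannMap φ D) {w : ℂ} (hw : w ∈ D) (ζ : ℂ) :
    StrictLipschitzAt (fun z => dist (diskInverse φ z) ζ) ‖deriv (diskInverse φ) w‖ w := by
  refine ⟨norm_nonneg _, fun η hη => ?_⟩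
  have hs : HasStrictDerivAt (diskInverse φ) (deriv (diskInverse φ) w) w :=
    (h.differentiableOn_diskInverse.analyticAt (h.isOpen.mem_nhds hw)).hasStrictDerivAt
  obtain ⟨N, hN, hlip⟩ := hs.hasStrictFDerivAt.exists_lipschitzOnWith_of_nnnorm_lt
    (.mk (‖deriv (diskInverse φ) w‖ + η) (by positivity)) (by
      rw [← NNReal.coe_lt_coe]
      simp [hη])
  refine ⟨N, hN, fun z hz z' hz' => ?_⟩
  rw [Real.dist_eq]
  exact (abs_dist_sub_le _ _ _).trans (hlip.dist_le_mul z hz z' hz')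

end IsRiemannMap

theorem StrictLipschitzAt.comp_lipschitzWith {G : ℂ → ℝ} {c : ℝ} {L : ℂ → ℂ} {z : ℂ} {K : ℝ}
    (hG : StrictLipschitzAt G c (L z)) (hK : 0 < K) (hL : ∀ w w', dist (L w) (L w') ≤ K * dist w w') :
    StrictLipschitzAt (G ∘ L) (c * K) z := by
  refine ⟨mul_nonneg hG.1 hK.le, fun η hη => ?_⟩
  obtain ⟨N, hN, h⟩ := hG.2 (η / K) (div_pos hη hK)
  have hc : Continuous L := (LipschitzWith.of_dist_le_mul (K := .mk K hK.le) hL).continuous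
  refine ⟨L ⁻¹' N, hc.continuousAt hN, fun w hw w' hw' => (h _ hw _ hw').trans ?_⟩
  have h0 : 0 ≤ c + η / K := add_nonneg hG.1 (div_pos hη hK).le
  calc (c + η / K) * dist (L w) (L w') ≤ (c + η / K) * (K * dist w w') :=
        mul_le_mul_of_nonneg_left (hL w w') h0
    _ = (c * K + η) * dist w w' := by field_simp

/-! ### Accumulation at arcs of the circle. -/

/-- Two connected subsets of the unit circle at distance at least `δ > 0`. -/
structure SeparatedArcs (P Q : Set ℂ) (δ : ℝ) : Prop where
  pos : 0 < δ
  left : IsConnected P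
  right : IsConnected Q
  left_subset : P ⊆ sphere 0 1
  right_subset : Q ⊆ sphere 0 1
  le_dist : ∀ ζ ∈ P, ∀ ζ' ∈ Q, δ ≤ dist ζ ζ'

theorem SeparatedArcs.symm {P Q : Set ℂ} {δ : ℝ} (h : SeparatedArcs P Q δ) :
    SeparatedArcs Q P δ :=
  ⟨h.pos, h.right, h.left, h.right_subset, h.left_subset, fun ζ hζ ζ' hζ' => by
    rw [dist_comm]; exact h.le_dist ζ' hζ' ζ hζ⟩

/-- In the disk model given by `φ`, the set `E` accumulates at a point of `P`. -/
def Accumulates (φ : ℂ → ℂ) (E P : Set ℂ) : Prop :=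
  ∃ ζ ∈ P, ζ ∈ closure (ball 0 1 ∩ φ ⁻¹' E)

namespace Accumulates

variable {φ : ℂ → ℂ} {D E E₁ E₂ P Q : Set ℂ}

theorem mono (h : Accumulates φ E₁ P) (hE : E₁ ⊆ E₂) : Accumulates φ E₂ P := by
  obtain ⟨ζ, hζ, hc⟩ := h
  exact ⟨ζ, hζ, closure_mono (inter_subset_inter_right _ (preimage_mono hE)) hc⟩

theorem of_union (h : Accumulates φ (E₁ ∪ E₂) P) : Accumulates φ E₁ P ∨ Accumulates φ E₂ P := by
  obtain ⟨ζ, hζ, hc⟩ := h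
  rw [preimage_union, inter_union_distrib_left, closure_union] at hc
  exact hc.imp (fun h => ⟨ζ, hζ, h⟩) (fun h => ⟨ζ, hζ, h⟩)

theorem inter_domain (hφ : IsRiemannMap φ D) (h : Accumulates φ E P) :
    Accumulates φ (E ∩ D) P := by
  obtain ⟨ζ, hζ, hc⟩ := h
  exact ⟨ζ, hζ, closure_mono (show ball 0 1 ∩ φ ⁻¹' E ⊆ ball 0 1 ∩ φ ⁻¹' (E ∩ D) from
    fun z hz => ⟨hz.1, hz.2, hφ.2.mapsTo hz.1⟩) hc⟩

theorem mono' (hφ : IsRiemannMap φ D) (h : Accumulates φ E₁ P)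
    (hE : ∀ z ∈ D, z ∈ E₁ → z ∈ E₂) : Accumulates φ E₂ P :=
  (h.inter_domain hφ).mono fun z hz => hE z hz.2 hz.1

theorem exists_dist_lt (hφ : IsRiemannMap φ D) (h : Accumulates φ E P) :
    ∃ ζ ∈ P, ∀ η > 0, ∃ z ∈ E ∩ D, dist (diskInverse φ z) ζ < η := by
  obtain ⟨ζ, hζ, hc⟩ := h
  refine ⟨ζ, hζ, fun η hη => ?_⟩
  obtain ⟨w, hw, hd⟩ := Metric.mem_closure_iff.1 hc η hη
  refine ⟨φ w, ⟨hw.2, hφ.2.mapsTo hw.1⟩, ?_⟩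
  rwa [hφ.diskInverse_apply hw.1, dist_comm]

theorem preimage_eq_image (hφ : IsRiemannMap φ D) (hE : E ⊆ D) :
    ball 0 1 ∩ φ ⁻¹' E = diskInverse φ '' E := by
  ext z
  constructor
  · exact fun hz => ⟨φ z, hz.2, hφ.diskInverse_apply hz.1⟩
  · rintro ⟨w, hw, rfl⟩
    refine ⟨hφ.diskInverse_mem (hE hw), ?_⟩
    rw [mem_preimage, hφ.apply_diskInverse (hE hw)]
    exact hw

/-- The image in the disk is again compact, hence closed and disjoint from the circle. -/
theorem not_of_isCompact (hφ : IsRiemannMap φ D) (hP : P ⊆ sphere 0 1) (hE : IsCompact E)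
    (hED : E ⊆ D) : ¬ Accumulates φ E P := by
  rintro ⟨ζ, hζ, hc⟩
  have : IsCompact (ball 0 1 ∩ φ ⁻¹' E) := by
    rw [preimage_eq_image hφ hED]
    exact hE.image_of_continuousOn (hφ.differentiableOn_diskInverse.continuousOn.mono hED)
  rw [this.isClosed.closure_eq] at hc
  have h1 := hP hζ
  have h2 := hc.1
  rw [mem_sphere_zero_iff_norm] at h1
  rw [mem_ball_zero_iff] at h2
  exact h2.ne h1

/-- If two disjoint open sets accumulate at a connected subset of the circle, so does every set
which separates them in `D`. -/
theorem of_separates (hφ : IsRiemannMap φ D) (hP : P ⊆ sphere 0 1) (hPc : IsPreconnected P)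
    {U V S : Set ℂ} (hU : IsOpen U) (hV : IsOpen V) (hUV : Disjoint U V)
    (hcov : ∀ z ∈ D, z ∈ U ∨ z ∈ V ∨ z ∈ S)
    (hUP : Accumulates φ U P) (hVP : Accumulates φ V P) : Accumulates φ S P := by
  by_contra hS
  set B : Set ℂ := ball 0 1
  have hsub : P ⊆ closure (B ∩ φ ⁻¹' U) ∪ closure (B ∩ φ ⁻¹' V) := by
    intro ζ hζ
    have h1 : ζ ∈ closure B := by
      rw [closure_ball _ one_ne_zero]
      exact sphere_subset_closedBall (hP hζ)
    have h2 : B ⊆ (B ∩ φ ⁻¹' U) ∪ (B ∩ φ ⁻¹' V) ∪ (B ∩ φ ⁻¹' S) := by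
      intro z hz
      rcases hcov _ (hφ.2.mapsTo hz) with h | h | h
      · exact Or.inl (Or.inl ⟨hz, h⟩)
      · exact Or.inl (Or.inr ⟨hz, h⟩)
      · exact Or.inr ⟨hz, h⟩
    have h3 := closure_mono h2 h1
    rw [closure_union, closure_union] at h3
    exact h3.resolve_right fun h => hS ⟨ζ, hζ, h⟩
  -- If `S` does not accumulate at `P`, the closures of the preimages of `U` and `V` cover `P`, so
  -- they meet in `P`.
  obtain ⟨ζ, hζ, hζU, hζV⟩ := isPreconnected_closed_iff.1 hPc _ _ isClosed_closure isClosed_closure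
    hsub hUP hVP
  have hζS : ζ ∉ closure (B ∩ φ ⁻¹' S) := fun h => hS ⟨ζ, hζ, h⟩
  obtain ⟨r, hr, hrS⟩ := Metric.isOpen_iff.1 isClosed_closure.isOpen_compl ζ hζS
  -- Near `ζ` the disk is convex and free of `S`, so it cannot be split between the disjoint open
  -- preimages of `U` and `V`.
  have hN : IsPreconnected (ball ζ r ∩ B) :=
    ((convex_ball ζ r).inter (convex_ball 0 1)).isPreconnected
  have hopen : ∀ W : Set ℂ, IsOpen W → IsOpen (B ∩ φ ⁻¹' W) := fun W hW =>
    hφ.continuousOn.isOpen_inter_preimage isOpen_ball hW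
  have hmeet : ∀ W : Set ℂ, ζ ∈ closure (B ∩ φ ⁻¹' W) →
      ((ball ζ r ∩ B) ∩ (B ∩ φ ⁻¹' W)).Nonempty := by
    intro W hW
    obtain ⟨w, hw, hd⟩ := Metric.mem_closure_iff.1 hW r hr
    exact ⟨w, ⟨by rwa [mem_ball, dist_comm], hw.1⟩, hw⟩
  obtain ⟨w, -, hw1, hw2⟩ := hN _ _ (hopen U hU) (hopen V hV) (by
    rintro z ⟨hz, hzB⟩
    rcases hcov _ (hφ.2.mapsTo hzB) with h | h | h
    · exact Or.inl ⟨hzB, h⟩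
    · exact Or.inr ⟨hzB, h⟩
    · exact absurd (subset_closure (s := B ∩ φ ⁻¹' S) ⟨hzB, h⟩) (hrS hz)) (hmeet U hζU) (hmeet V hζV)
  exact disjoint_left.1 hUV hw1.2 hw2.2

end Accumulates

theorem PlaneCurve.isPreconnected_trace (γ : PlaneCurve) : IsPreconnected γ.trace :=
  γ.ordConnected.isPreconnected.image _ γ.continuousOn

/-! ### Connecting curves in terms of accumulation. -/

section ConnectingCurves

variable {φ : ℂ → ℂ} {D P Q : Set ℂ} {δ : ℝ}

/-- Otherwise the closure of `P` would split off from the connected union: it stays on the circle,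
so it misses the curve, and the distance `δ` keeps it away from `Q`. -/
theorem accumulates_of_mem_connectingCurves (hPQ : SeparatedArcs P Q δ) {γ : PlaneCurve}
    (hγ : γ ∈ connectingCurves φ D P Q) : Accumulates φ γ.trace P := by
  set S := ball (0 : ℂ) 1 ∩ φ ⁻¹' γ.trace
  have hQP : ∀ ζ ∈ P, ζ ∉ closure Q := by
    intro ζ hζ hc
    obtain ⟨ζ', hζ', hd⟩ := Metric.mem_closure_iff.1 hc δ hPQ.pos
    exact (hPQ.le_dist ζ hζ ζ' hζ').not_gt hd
  obtain ⟨ζ₀, hζ₀⟩ := hPQ.left.nonempty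
  obtain ⟨ζ₁, hζ₁⟩ := hPQ.right.nonempty
  obtain ⟨ζ, hζ, hζP, hζSQ⟩ := isPreconnected_closed_iff.1 hγ.2.isPreconnected (closure P)
    (closure (S ∪ Q)) isClosed_closure isClosed_closure (by
      rintro z ((hz | hz) | hz)
      · exact Or.inl (subset_closure hz)
      · exact Or.inr (subset_closure (Or.inl hz))
      · exact Or.inr (subset_closure (Or.inr hz)))
    ⟨ζ₀, Or.inl (Or.inl hζ₀), subset_closure hζ₀⟩ ⟨ζ₁, Or.inr hζ₁, subset_closure (Or.inr hζ₁)⟩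
  have hPs : closure P ⊆ sphere 0 1 := closure_minimal hPQ.left_subset isClosed_sphere
  rcases hζ with (hz | hz) | hz
  · rw [closure_union] at hζSQ
    exact ⟨ζ, hz, hζSQ.resolve_right (hQP ζ hz)⟩
  · have h1 := hPs hζP
    have h2 := hz.1
    rw [mem_sphere_zero_iff_norm] at h1
    rw [mem_ball_zero_iff] at h2
    exact absurd h1 h2.ne
  · obtain ⟨ζ', hζ', hd⟩ := Metric.mem_closure_iff.1 hζP δ hPQ.pos
    exact absurd (hPQ.le_dist ζ' hζ' ζ hz) (by rw [dist_comm]; exact hd.not_ge)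

theorem accumulates_right_of_mem_connectingCurves (hPQ : SeparatedArcs P Q δ) {γ : PlaneCurve}
    (hγ : γ ∈ connectingCurves φ D P Q) : Accumulates φ γ.trace Q := by
  refine accumulates_of_mem_connectingCurves (D := D) hPQ.symm ⟨hγ.1, ?_⟩
  have := hγ.2
  rwa [union_right_comm, union_comm P Q, union_right_comm] at this

/-- A connected set stays connected when limit points are added, and these limit points lie on the
arcs, which are themselves connected. -/
theorem mem_connectingCurves (hφ : IsRiemannMap φ D) (hPQ : SeparatedArcs P Q δ) {γ : PlaneCurve}
    (hγ : γ.trace ⊆ D) (hP : Accumulates φ γ.trace P) (hQ : Accumulates φ γ.trace Q) :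
    γ ∈ connectingCurves φ D P Q := by
  refine ⟨hγ, ?_⟩
  set S := ball (0 : ℂ) 1 ∩ φ ⁻¹' γ.trace with hS
  obtain ⟨ζ, hζ, hζS⟩ := hP
  obtain ⟨ζ', hζ', hζS'⟩ := hQ
  have hSc : IsConnected S := by
    refine ⟨closure_nonempty_iff.1 ⟨ζ, hζS⟩, ?_⟩
    rw [hS, Accumulates.preimage_eq_image hφ hγ]
    exact γ.isPreconnected_trace.image _
      (hφ.differentiableOn_diskInverse.continuousOn.mono hγ)
  have h1 : IsConnected (insert ζ (insert ζ' S)) :=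
    hSc.subset_closure (fun z hz => Or.inr (Or.inr hz))
      (insert_subset hζS (insert_subset hζS' subset_closure))
  have h2 := (h1.union ⟨ζ, mem_insert _ _, hζ⟩ hPQ.left)
  have h3 := (h2.union ⟨ζ', Or.inl (mem_insert_of_mem _ (mem_insert _ _)), hζ'⟩ hPQ.right)
  convert h3 using 1
  ext z
  simp only [mem_union, mem_insert_iff]
  constructor
  · tauto
  · rintro (((rfl | rfl | h) | h) | h) <;> tauto

end ConnectingCurves

/-! ### Vertical slices and their two ends. -/

theorem mem_graphDomain_bot_top {F : ℝ → ℝ≥0∞} {z : ℂ} :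
    z ∈ graphDomain ⊥ ⊤ F ↔ 0 < z.im ∧ ENNReal.ofReal z.im < F z.re := by
  simp [graphDomain]

/-- The lower end of the vertical slice at `x` accumulates at `P`. -/
def BottomAccumulates (φ : ℂ → ℂ) (x : ℝ) (P : Set ℂ) : Prop :=
  ∀ κ > 0, Accumulates φ {z | z.re = x ∧ z.im < κ} P

/-- The upper end of the vertical slice at `x` accumulates at `P`. -/
def TopAccumulates (φ : ℂ → ℂ) (F : ℝ → ℝ≥0∞) (x : ℝ) (P : Set ℂ) : Prop :=
  ∀ κ, ENNReal.ofReal κ < F x → Accumulates φ {z | z.re = x ∧ κ < z.im} P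

section Slices

variable {φ : ℂ → ℂ} {F : ℝ → ℝ≥0∞} {P Q : Set ℂ} {δ : ℝ}

theorem isCompact_graph {g : ℝ → ℝ} (hg : Continuous g) (a b : ℝ) :
    IsCompact {z : ℂ | a ≤ z.re ∧ z.re ≤ b ∧ z.im = g z.re} := by
  have : {z : ℂ | a ≤ z.re ∧ z.re ≤ b ∧ z.im = g z.re} =
      (fun x : ℝ => (x : ℂ) + (g x : ℝ) * Complex.I) '' Icc a b := by
    ext z
    constructor
    · rintro ⟨h1, h2, h3⟩
      exact ⟨z.re, ⟨h1, h2⟩, by apply Complex.ext <;> simp [h3]⟩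
    · rintro ⟨x, hx, rfl⟩
      simp [hx.1, hx.2]
  rw [this]
  exact isCompact_Icc.image (by fun_prop)

theorem isCompact_verticalSegment (x a b : ℝ) :
    IsCompact {z : ℂ | z.re = x ∧ a ≤ z.im ∧ z.im ≤ b} := by
  have : {z : ℂ | z.re = x ∧ a ≤ z.im ∧ z.im ≤ b} =
      (fun y : ℝ => (x : ℂ) + (y : ℝ) * Complex.I) '' Icc a b := by
    ext z
    constructor
    · rintro ⟨rfl, h⟩
      exact ⟨z.im, h, by apply Complex.ext <;> simp⟩
    · rintro ⟨x, hx, rfl⟩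
      simp [hx.1, hx.2]
  rw [this]
  exact isCompact_Icc.image (by fun_prop)

variable (hφ : IsRiemannMap φ (graphDomain ⊥ ⊤ F))
include hφ

theorem not_accumulates_verticalSegment (hP : P ⊆ sphere 0 1) {x a b : ℝ} (ha : 0 < a)
    (hb : ENNReal.ofReal b < F x) : ¬ Accumulates φ {z | z.re = x ∧ a ≤ z.im ∧ z.im ≤ b} P := by
  refine Accumulates.not_of_isCompact hφ hP (isCompact_verticalSegment x a b) ?_
  rintro z ⟨rfl, h1, h2⟩
  exact mem_graphDomain_bot_top.2 ⟨ha.trans_le h1, (ENNReal.ofReal_le_ofReal h2).trans_lt hb⟩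

/-- The part of the slice between two heights is compact in `D`, so only the lower end can account
for the accumulation. -/
theorem bottomAccumulates_of_accumulates (hP : P ⊆ sphere 0 1) {x κ : ℝ}
    (hκ : ENNReal.ofReal κ < F x) (h : Accumulates φ {z | z.re = x ∧ z.im ≤ κ} P) :
    BottomAccumulates φ x P := by
  intro η hη
  refine ((h.mono ?_).of_union).resolve_right
    (not_accumulates_verticalSegment hφ hP hη hκ)
  rintro z ⟨h1, h2⟩
  rcases lt_or_ge z.im η with h | h
  · exact Or.inl ⟨h1, h⟩
  · exact Or.inr ⟨h1, h, h2⟩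

theorem topAccumulates_of_accumulates (hP : P ⊆ sphere 0 1) {x κ : ℝ}
    (hκ : 0 < κ) (h : Accumulates φ {z | z.re = x ∧ κ ≤ z.im} P) :
    TopAccumulates φ F x P := by
  intro η hη
  refine ((h.mono ?_).of_union).resolve_right
    (not_accumulates_verticalSegment hφ hP hκ hη)
  rintro z ⟨h1, h2⟩
  rcases lt_or_ge η z.im with h | h
  · exact Or.inl ⟨h1, h⟩
  · exact Or.inr ⟨h1, h2, h⟩

theorem bottom_or_top_of_accumulates (hP : P ⊆ sphere 0 1) {x : ℝ} (hx : 0 < F x)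
    (h : Accumulates φ {z | z.re = x} P) :
    BottomAccumulates φ x P ∨ TopAccumulates φ F x P := by
  obtain ⟨κ, hκ0, hκ⟩ := ENNReal.lt_iff_exists_real_btwn.1 hx
  have hκpos : 0 < κ := ENNReal.ofReal_pos.1 hκ.1
  refine (Accumulates.of_union (h.mono ?_)).imp (bottomAccumulates_of_accumulates hφ hP hκ.2)
    (topAccumulates_of_accumulates hφ hP hκpos)
  intro z hz
  rcases le_total z.im κ with h | h
  · exact Or.inl ⟨hz, h⟩
  · exact Or.inr ⟨hz, h⟩

theorem pos_of_accumulates {x : ℝ} (h : Accumulates φ {z | z.re = x} P) : 0 < F x := by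
  obtain ⟨ζ, -, h⟩ := h.exists_dist_lt hφ
  obtain ⟨z, hz, -⟩ := h 1 one_pos
  have := (mem_graphDomain_bot_top.1 hz.2).2
  rw [hz.1] at this
  exact bot_le.trans_lt this

/-- A vertical line separating two sets which accumulate at `P` accumulates at `P`. -/
theorem accumulates_slice (hP : P ⊆ sphere 0 1) (hPc : IsPreconnected P) {x : ℝ} {E₁ E₂ : Set ℂ}
    (h₁ : ∀ z ∈ E₁, z.re < x) (h₂ : ∀ z ∈ E₂, x < z.re) (hE₁ : Accumulates φ E₁ P)
    (hE₂ : Accumulates φ E₂ P) : Accumulates φ {z | z.re = x} P := by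
  refine Accumulates.of_separates hφ hP hPc (U := {z | z.re < x}) (V := {z | x < z.re})
    (isOpen_lt Complex.continuous_re continuous_const)
    (isOpen_lt continuous_const Complex.continuous_re)
    (disjoint_left.2 fun z (h : z.re < x) (h' : x < z.re) => h.not_gt h') ?_
    (hE₁.mono h₁) (hE₂.mono h₂)
  intro z _
  rcases lt_trichotomy z.re x with h | h | h
  exacts [Or.inl h, Or.inr (Or.inr h), Or.inr (Or.inl h)]

/-- The slices at `x` and `x'` cannot end at `P` at opposite ends only. -/
theorem topAccumulates_or_bottomAccumulates (hF : LowerSemicontinuous F) (hP : P ⊆ sphere 0 1)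
    (hPc : IsPreconnected P) {x x' : ℝ} (hx : x < x') (hpos : ∀ y ∈ Icc x x', 0 < F y)
    (h : BottomAccumulates φ x P) (h' : TopAccumulates φ F x' P) :
    TopAccumulates φ F x P ∨ BottomAccumulates φ x' P := by
  -- Lower semicontinuity gives a positive minimum of `F`, hence a horizontal segment in `D` over
  -- all of `[x, x']`.
  obtain ⟨y, hy, hmin⟩ := (hF.lowerSemicontinuousOn (Icc x x')).exists_isMinOn
    (nonempty_Icc.2 hx.le) isCompact_Icc
  obtain ⟨κ, -, hκ⟩ := ENNReal.lt_iff_exists_real_btwn.1 (hpos y hy)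
  have hκ0 : 0 < κ := ENNReal.ofReal_pos.1 hκ.1
  have hκF : ∀ t ∈ Icc x x', ENNReal.ofReal κ < F t := fun t ht => hκ.2.trans_le (hmin ht)
  have hre := Complex.continuous_re
  have him := Complex.continuous_im
  -- The separating set is a staircase: the slice at `x` above `κ`, the slice at `x'` below `κ`, and
  -- the horizontal segment joining them, which is compact.
  have hS := Accumulates.of_separates hφ hP hPc
    (U := {z | z.re < x} ∪ {z | z.re < x' ∧ z.im < κ})
    (V := {z | x' < z.re} ∪ {z | x < z.re ∧ κ < z.im})
    (S := {z | z.re = x ∧ κ ≤ z.im} ∪ {z | z.re = x' ∧ z.im ≤ κ} ∪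
      {z | x ≤ z.re ∧ z.re ≤ x' ∧ z.im = κ})
    ((isOpen_lt hre continuous_const).union
      ((isOpen_lt hre continuous_const).inter (isOpen_lt him continuous_const)))
    ((isOpen_lt continuous_const hre).union
      ((isOpen_lt continuous_const hre).inter (isOpen_lt continuous_const him)))
    (disjoint_left.2 (by
      intro z hU hV
      simp only [mem_union, mem_ofPred_eq] at hU hV
      rcases hU with h | ⟨h1, h2⟩ <;> rcases hV with h' | ⟨h3, h4⟩ <;> linarith))
    (by
      intro z _
      simp only [mem_union, mem_ofPred_eq]
      rcases lt_trichotomy z.re x with h | h | h <;> rcases lt_trichotomy z.re x' with h' | h' | h' <;>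
        rcases lt_trichotomy z.im κ with h'' | h'' | h'' <;>
        simp [h, h', h'', h.le, h'.le, h''.le, hx])
    ((h κ hκ0).mono fun z hz => Or.inr ⟨hz.1.trans_lt hx, hz.2⟩)
    ((h' κ (hκF x' (right_mem_Icc.2 hx.le))).mono fun z hz => Or.inr ⟨hx.trans_eq hz.1.symm, hz.2⟩)
  rcases hS.of_union with hS | hS
  · exact hS.of_union.imp (topAccumulates_of_accumulates hφ hP hκ0)
      (bottomAccumulates_of_accumulates hφ hP (hκF x' (right_mem_Icc.2 hx.le)))
  · refine absurd hS (Accumulates.not_of_isCompact hφ hP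
      (isCompact_graph (g := fun _ => κ) continuous_const x x') ?_)
    rintro z ⟨h1, h2, h3⟩
    refine mem_graphDomain_bot_top.2 ⟨by rw [h3]; exact hκ0, ?_⟩
    rw [h3]
    exact hκF _ ⟨h1, h2⟩

theorem not_accumulates_graph (hP : P ⊆ sphere 0 1)
    {x₁ x₂ : ℝ} {g : ℝ → ℝ} (hg : Continuous g) (hg0 : ∀ x ∈ Icc x₁ x₂, 0 < g x)
    (hgF : ∀ x ∈ Icc x₁ x₂, ENNReal.ofReal (g x) < F x) :
    ¬ Accumulates φ {z | x₁ ≤ z.re ∧ z.re ≤ x₂ ∧ z.im = g z.re} P := by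
  refine Accumulates.not_of_isCompact hφ hP (isCompact_graph hg x₁ x₂) ?_
  rintro z ⟨h1, h2, h3⟩
  refine mem_graphDomain_bot_top.2 ⟨?_, ?_⟩ <;> rw [h3]
  exacts [hg0 _ ⟨h1, h2⟩, hgF _ ⟨h1, h2⟩]

/-- If a set above a graph over `[x₁, x₂]` and a slice to the right of it accumulate at `P`, then
so does the upper end of one of the two bounding slices. -/
theorem topAccumulates_of_above_graph (hP : P ⊆ sphere 0 1) (hPc : IsPreconnected P)
    {x₁ x₂ x₃ : ℝ} (h12 : x₁ ≤ x₂) (h23 : x₂ < x₃) {g : ℝ → ℝ} (hg : Continuous g)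
    (hg0 : ∀ x ∈ Icc x₁ x₂, 0 < g x) (hgF : ∀ x ∈ Icc x₁ x₂, ENNReal.ofReal (g x) < F x)
    {E : Set ℂ} (hE : ∀ z ∈ E, x₁ < z.re ∧ z.re < x₂ ∧ g z.re < z.im) (hEP : Accumulates φ E P)
    (h₃ : Accumulates φ {z | z.re = x₃} P) :
    TopAccumulates φ F x₁ P ∨ TopAccumulates φ F x₂ P := by
  have hre := Complex.continuous_re
  have him := Complex.continuous_im
  have hgr := hg.comp hre
  -- The region above the graph is bounded by two upper half-slices and a compact graph; the slice
  -- at `x₃` serves only as an accumulating set on the other side.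
  have hS := Accumulates.of_separates hφ hP hPc
    (U := {z | x₁ < z.re ∧ z.re < x₂ ∧ g z.re < z.im})
    (V := {z | z.re < x₁} ∪ {z | x₂ < z.re} ∪ {z | z.im < g z.re})
    (S := {z | z.re = x₁ ∧ g x₁ ≤ z.im} ∪ {z | z.re = x₂ ∧ g x₂ ≤ z.im} ∪
      {z | x₁ ≤ z.re ∧ z.re ≤ x₂ ∧ z.im = g z.re})
    ((isOpen_lt continuous_const hre).inter ((isOpen_lt hre continuous_const).inter
      (isOpen_lt hgr him)))
    (((isOpen_lt hre continuous_const).union (isOpen_lt continuous_const hre)).union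
      (isOpen_lt him hgr))
    (disjoint_left.2 (by
      rintro z ⟨h1, h2, h3⟩ ((h' | h') | h') <;> simp only [mem_ofPred_eq] at * <;> linarith))
    (by
      intro z _
      simp only [mem_union, mem_ofPred_eq]
      rcases lt_or_ge z.im (g z.re) with h'' | h''
      · tauto
      rcases lt_trichotomy z.re x₁ with h | h | h
      · tauto
      · subst h; tauto
      rcases lt_trichotomy z.re x₂ with h' | h' | h'
      · rcases h''.lt_or_eq with h3 | h3
        · tauto
        · exact Or.inr (Or.inr (Or.inr ⟨h.le, h'.le, h3.symm⟩))
      · subst h'; tauto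
      · tauto)
    (hEP.mono hE) (h₃.mono fun z (hz : z.re = x₃) => Or.inl (Or.inr (h23.trans_eq hz.symm)))
  rcases hS.of_union with hS | hS
  · exact hS.of_union.imp (topAccumulates_of_accumulates hφ hP (hg0 _ (left_mem_Icc.2 h12)))
      (topAccumulates_of_accumulates hφ hP (hg0 _ (right_mem_Icc.2 h12)))
  · exact absurd hS (not_accumulates_graph hφ hP hg hg0 hgF)

/-- If a set below a graph over `[x₁, x₂]` and a slice to the right of it accumulate at `P`, then
so does the lower end of one of the two bounding slices. -/
theorem bottomAccumulates_of_below_graph (hP : P ⊆ sphere 0 1) (hPc : IsPreconnected P)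
    {x₁ x₂ x₃ : ℝ} (h12 : x₁ ≤ x₂) (h23 : x₂ < x₃) {g : ℝ → ℝ} (hg : Continuous g)
    (hg0 : ∀ x ∈ Icc x₁ x₂, 0 < g x) (hgF : ∀ x ∈ Icc x₁ x₂, ENNReal.ofReal (g x) < F x)
    {E : Set ℂ} (hE : ∀ z ∈ E, x₁ < z.re ∧ z.re < x₂ ∧ z.im < g z.re) (hEP : Accumulates φ E P)
    (h₃ : Accumulates φ {z | z.re = x₃} P) :
    BottomAccumulates φ x₁ P ∨ BottomAccumulates φ x₂ P := by
  have hre := Complex.continuous_re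
  have him := Complex.continuous_im
  have hgr := hg.comp hre
  have hS := Accumulates.of_separates hφ hP hPc
    (U := {z | x₁ < z.re ∧ z.re < x₂ ∧ z.im < g z.re})
    (V := {z | z.re < x₁} ∪ {z | x₂ < z.re} ∪ {z | g z.re < z.im})
    (S := {z | z.re = x₁ ∧ z.im ≤ g x₁} ∪ {z | z.re = x₂ ∧ z.im ≤ g x₂} ∪
      {z | x₁ ≤ z.re ∧ z.re ≤ x₂ ∧ z.im = g z.re})
    ((isOpen_lt continuous_const hre).inter ((isOpen_lt hre continuous_const).inter
      (isOpen_lt him hgr)))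
    (((isOpen_lt hre continuous_const).union (isOpen_lt continuous_const hre)).union
      (isOpen_lt hgr him))
    (disjoint_left.2 (by
      rintro z ⟨h1, h2, h3⟩ ((h' | h') | h') <;> simp only [mem_ofPred_eq] at * <;> linarith))
    (by
      intro z _
      simp only [mem_union, mem_ofPred_eq]
      rcases lt_or_ge (g z.re) z.im with h'' | h''
      · tauto
      rcases lt_trichotomy z.re x₁ with h | h | h
      · tauto
      · subst h; tauto
      rcases lt_trichotomy z.re x₂ with h' | h' | h'
      · rcases h''.lt_or_eq with h3 | h3
        · tauto
        · exact Or.inr (Or.inr (Or.inr ⟨h.le, h'.le, h3⟩))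
      · subst h'; tauto
      · tauto)
    (hEP.mono hE) (h₃.mono fun z (hz : z.re = x₃) => Or.inl (Or.inr (h23.trans_eq hz.symm)))
  rcases hS.of_union with hS | hS
  · exact hS.of_union.imp
      (bottomAccumulates_of_accumulates hφ hP (hgF _ (left_mem_Icc.2 h12)))
      (bottomAccumulates_of_accumulates hφ hP (hgF _ (right_mem_Icc.2 h12)))
  · exact absurd hS (not_accumulates_graph hφ hP hg hg0 hgF)

end Slices

/-! ### Good slices and their orientation. -/

theorem lintegral_complex_eq_lintegral_lintegral {h : ℂ → ℝ≥0∞} (hh : Measurable h) :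
    ∫⁻ z, h z = ∫⁻ x : ℝ, ∫⁻ y : ℝ, h ⟨x, y⟩ := by
  have := Complex.volume_preserving_equiv_real_prod.symm.lintegral_comp hh
  rw [← this, Measure.volume_eq_prod, lintegral_prod]
  · rfl
  · exact (hh.comp Complex.measurableEquivRealProd.symm.measurable).aemeasurable

/-- The heights of the points of a vertical slice of length `h`. -/
def heightSet (h : ℝ≥0∞) : Set ℝ := {y | 0 < y ∧ ENNReal.ofReal y < h}

theorem volume_heightSet (h : ℝ≥0∞) : volume (heightSet h) = h := by
  rcases eq_or_ne h ∞ with rfl | hh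
  · have : heightSet ∞ = Ioi 0 := by ext y; simp [heightSet]
    rw [this, Real.volume_Ioi]
  · have : heightSet h = Ioo 0 h.toReal := by
      ext y
      simp only [heightSet, mem_ofPred_eq, mem_Ioo]
      exact and_congr_right fun hy => ENNReal.ofReal_lt_iff_lt_toReal hy.le hh
    rw [this, Real.volume_Ioo, sub_zero, ENNReal.ofReal_toReal hh]

theorem measurableSet_heightSet (h : ℝ≥0∞) : MeasurableSet (heightSet h) :=
  measurableSet_Ioi.inter (ENNReal.measurable_ofReal measurableSet_Iio)

theorem measurableSet_graphDomain {F : ℝ → ℝ≥0∞} (hF : Measurable F) :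
    MeasurableSet (graphDomain ⊥ ⊤ F) := by
  have : graphDomain ⊥ ⊤ F = {z : ℂ | 0 < z.im} ∩ {z | ENNReal.ofReal z.im < F z.re} := by
    ext z; exact mem_graphDomain_bot_top
  rw [this]
  exact (measurableSet_lt measurable_const Complex.measurable_im).inter
    (measurableSet_lt (ENNReal.measurable_ofReal.comp Complex.measurable_im)
      (hF.comp Complex.measurable_re))

theorem setLIntegral_graphDomain {F : ℝ → ℝ≥0∞} (hF : Measurable F) {h : ℂ → ℝ≥0∞}
    (hh : Measurable h) :
    ∫⁻ z in graphDomain ⊥ ⊤ F, h z = ∫⁻ x, ∫⁻ y in heightSet (F x), h ⟨x, y⟩ := by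
  have hD := measurableSet_graphDomain hF
  rw [← lintegral_indicator hD, lintegral_complex_eq_lintegral_lintegral (hh.indicator hD)]
  refine lintegral_congr fun x => ?_
  rw [← lintegral_indicator (measurableSet_heightSet _)]
  refine lintegral_congr fun y => ?_
  have : (⟨x, y⟩ : ℂ) ∈ graphDomain ⊥ ⊤ F ↔ y ∈ heightSet (F x) := mem_graphDomain_bot_top
  by_cases hy : y ∈ heightSet (F x)
  · rw [indicator_of_mem hy, indicator_of_mem (this.2 hy)]
  · rw [indicator_of_notMem hy, indicator_of_notMem (mt this.1 hy)]

theorem volume_graphDomain {F : ℝ → ℝ≥0∞} (hF : Measurable F) :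
    volume (graphDomain ⊥ ⊤ F) = ∫⁻ x, F x := by
  have := setLIntegral_graphDomain hF (h := fun _ => 1) measurable_const
  simpa [volume_heightSet] using this

/-- The slice at `x` is finite, and its image in the disk has finite length. -/
def IsGoodSlice (φ : ℂ → ℂ) (F : ℝ → ℝ≥0∞) (x : ℝ) : Prop :=
  F x ≠ ∞ ∧ ∫⁻ y in heightSet (F x), ‖deriv (diskInverse φ) ⟨x, y⟩‖ₑ ≠ ∞

section GoodSlices

variable {φ : ℂ → ℂ} {F : ℝ → ℝ≥0∞} {P Q : Set ℂ} {δ : ℝ}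
  (hφ : IsRiemannMap φ (graphDomain ⊥ ⊤ F))
include hφ

/-- The inequality `t ≤ 1 + t²` turns finite area and finite energy into integrability of the
derivative over `D`; Fubini does the rest. -/
theorem ae_isGoodSlice (hF : Measurable F) (harea : volume (graphDomain ⊥ ⊤ F) < ∞) :
    ∀ᵐ x, IsGoodSlice φ F x := by
  have h1 : ∀ᵐ x, F x < ∞ := ae_lt_top hF (by rw [← volume_graphDomain hF]; exact harea.ne)
  have hm : Measurable fun z => ‖deriv (diskInverse φ) z‖ₑ := (measurable_deriv _).enorm
  have hfin : ∫⁻ z in graphDomain ⊥ ⊤ F, ‖deriv (diskInverse φ) z‖ₑ < ∞ := by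
    calc ∫⁻ z in graphDomain ⊥ ⊤ F, ‖deriv (diskInverse φ) z‖ₑ
        ≤ ∫⁻ z in graphDomain ⊥ ⊤ F, (1 + ‖deriv (diskInverse φ) z‖ₑ ^ 2) := by
          refine lintegral_mono fun z => ?_
          rcases le_total ‖deriv (diskInverse φ) z‖ₑ 1 with h | h
          · exact h.trans le_self_add
          · exact (le_self_pow₀ h two_ne_zero).trans le_add_self
      _ = volume (graphDomain ⊥ ⊤ F) +
          ∫⁻ z in graphDomain ⊥ ⊤ F, ‖deriv (diskInverse φ) z‖ₑ ^ 2 := by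
          rw [lintegral_add_left measurable_const, setLIntegral_one]
      _ < ∞ := ENNReal.add_lt_top.2 ⟨harea, hφ.lintegral_enorm_deriv_diskInverse_sq_lt_top⟩
  rw [setLIntegral_graphDomain hF hm] at hfin
  have hmeas : Measurable fun x => ∫⁻ y in heightSet (F x), ‖deriv (diskInverse φ) ⟨x, y⟩‖ₑ := by
    have : (fun x => ∫⁻ y in heightSet (F x), ‖deriv (diskInverse φ) ⟨x, y⟩‖ₑ) = fun x =>
        ∫⁻ y, (graphDomain ⊥ ⊤ F).indicator (fun z => ‖deriv (diskInverse φ) z‖ₑ)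
          (Complex.measurableEquivRealProd.symm (x, y)) := by
      ext x
      rw [← lintegral_indicator (measurableSet_heightSet _)]
      refine lintegral_congr fun y => ?_
      have : Complex.measurableEquivRealProd.symm (x, y) ∈ graphDomain ⊥ ⊤ F ↔
        y ∈ heightSet (F x) := mem_graphDomain_bot_top
      by_cases hy : y ∈ heightSet (F x)
      · rw [indicator_of_mem hy, indicator_of_mem (this.2 hy)]
        rfl
      · rw [indicator_of_notMem hy, indicator_of_notMem (mt this.1 hy)]
    rw [this]
    exact ((hm.indicator (measurableSet_graphDomain hF)).comp
      Complex.measurableEquivRealProd.symm.measurable).lintegral_prod_right'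
  filter_upwards [h1, ae_lt_top hmeas hfin.ne] with x hx1 hx2 using ⟨hx1.ne, hx2.ne⟩

theorem edist_dist_diskInverse_le {x s t : ℝ} (hst : s ≤ t)
    (hD : ∀ y ∈ Icc s t, (⟨x, y⟩ : ℂ) ∈ graphDomain ⊥ ⊤ F) (ζ : ℂ) :
    edist (dist (diskInverse φ ⟨x, s⟩) ζ) (dist (diskInverse φ ⟨x, t⟩) ζ) ≤
      ∫⁻ y in Icc s t, ‖deriv (diskInverse φ) ⟨x, y⟩‖ₑ := by
  have hlip : LipschitzOnWith 1 (fun l : ℝ => (⟨x, l + s⟩ : ℂ)) (Icc 0 (t - s)) := by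
    refine LipschitzOnWith.of_dist_le_mul fun l _ l' _ => ?_
    rw [Complex.dist_of_re_eq (z := ⟨x, l + s⟩) (w := ⟨x, l' + s⟩) rfl]
    simp
  have key := edist_le_lintegral_of_strictLipschitzAt (sub_nonneg.2 hst) hlip
    (G := fun z => dist (diskInverse φ z) ζ) (ρ := fun z => ‖deriv (diskInverse φ) z‖ₑ) (by
      intro l hl
      refine ⟨_, (ofReal_norm _).le, hφ.strictLipschitzAt_dist (hD _ ⟨?_, ?_⟩) ζ⟩ <;>
        linarith [hl.1, hl.2])
  have hmp := (measurePreserving_add_right volume s).setLIntegral_comp_preimage_emb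
    (measurableEmbedding_addRight s) (fun y => ‖deriv (diskInverse φ) ⟨x, y⟩‖ₑ) (Icc s t)
  rw [preimage_add_const_Icc, sub_self] at hmp
  rw [hmp] at key
  simpa using key

/-- A piece of a slice whose image in the disk is short accumulates at most at one of two separated
arcs. -/
theorem not_accumulates_both_of_lintegral_lt (hPQ : SeparatedArcs P Q δ) {x : ℝ} {J : Set ℝ}
    (hJ : J.OrdConnected) (hJF : J ⊆ heightSet (F x))
    (hlt : ∫⁻ y in J, ‖deriv (diskInverse φ) ⟨x, y⟩‖ₑ < ENNReal.ofReal (δ / 2)) :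
    ¬ (Accumulates φ {z | z.re = x ∧ z.im ∈ J} P ∧ Accumulates φ {z | z.re = x ∧ z.im ∈ J} Q) := by
  rintro ⟨hP, hQ⟩
  obtain ⟨ζ, hζ, h1⟩ := hP.exists_dist_lt hφ
  obtain ⟨ζ', hζ', h2⟩ := hQ.exists_dist_lt hφ
  have hδ := hPQ.pos
  -- With both errors below `δ/4`, the distance to `ζ` changes by more than `δ/2` between `z` and
  -- `z'`, which exceeds the length of the image.
  obtain ⟨z, ⟨⟨hzx, hzJ⟩, -⟩, hz⟩ := h1 (δ / 4) (by positivity)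
  obtain ⟨z', ⟨⟨hzx', hzJ'⟩, -⟩, hz'⟩ := h2 (δ / 4) (by positivity)
  have key : ∀ s ∈ J, ∀ t ∈ J, s ≤ t →
      edist (dist (diskInverse φ ⟨x, s⟩) ζ) (dist (diskInverse φ ⟨x, t⟩) ζ) <
        ENNReal.ofReal (δ / 2) := by
    intro s hs t ht hst
    refine ((edist_dist_diskInverse_le hφ hst ?_ ζ).trans
      (lintegral_mono_set (hJ.out hs ht))).trans_lt hlt
    exact fun y hy => mem_graphDomain_bot_top.2 (hJF (hJ.out hs ht hy))
  have h3 : edist (dist (diskInverse φ z) ζ) (dist (diskInverse φ z') ζ) <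
      ENNReal.ofReal (δ / 2) := by
    have e : z = ⟨x, z.im⟩ := Complex.ext hzx rfl
    have e' : z' = ⟨x, z'.im⟩ := Complex.ext hzx' rfl
    rw [e, e']
    rcases le_total z.im z'.im with h | h
    · exact key _ hzJ _ hzJ' h
    · rw [edist_comm]
      exact key _ hzJ' _ hzJ h
  rw [edist_lt_ofReal, Real.dist_eq] at h3
  have h4 := hPQ.le_dist ζ hζ ζ' hζ'
  have h5 := dist_triangle_left ζ ζ' (diskInverse φ z')
  have h6 := (abs_lt.1 h3).1
  linarith

/-- By absolute continuity of the integral, a short enough lower end has an image of length below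
`δ/2`. -/
theorem IsGoodSlice.not_bottomAccumulates_both (hPQ : SeparatedArcs P Q δ) {x : ℝ}
    (hx : IsGoodSlice φ F x) (hpos : 0 < F x) :
    ¬ (BottomAccumulates φ x P ∧ BottomAccumulates φ x Q) := by
  rintro ⟨hP, hQ⟩
  obtain ⟨r, hr, hsmall⟩ := exists_pos_setLIntegral_lt_of_measure_lt hx.2
    (ENNReal.ofReal_pos.2 (half_pos hPQ.pos)).ne'
  obtain ⟨κ, -, hκ0, hκ⟩ := ENNReal.lt_iff_exists_real_btwn.1 (lt_min hpos hr)
  have hκpos : 0 < κ := ENNReal.ofReal_pos.1 hκ0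
  have hsub : Ioo 0 κ ⊆ heightSet (F x) := fun y hy =>
    ⟨hy.1, (ENNReal.ofReal_le_ofReal hy.2.le).trans_lt (hκ.trans_le (min_le_left _ _))⟩
  have hJ : ∀ R, BottomAccumulates φ x R → Accumulates φ {z | z.re = x ∧ z.im ∈ Ioo 0 κ} R :=
    fun R hR => (hR κ hκpos).mono' hφ fun z hz hz' =>
      ⟨hz'.1, (mem_graphDomain_bot_top.1 hz).1, hz'.2⟩
  refine not_accumulates_both_of_lintegral_lt hφ hPQ ordConnected_Ioo hsub ?_ ⟨hJ P hP, hJ Q hQ⟩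
  have := hsmall (Ioo 0 κ) ((Measure.restrict_apply_le _ _).trans_lt (by
    rw [Real.volume_Ioo, sub_zero]
    exact hκ.trans_le (min_le_right _ _)))
  rwa [Measure.restrict_restrict measurableSet_Ioo, inter_eq_left.2 hsub] at this

theorem IsGoodSlice.not_topAccumulates_both (hPQ : SeparatedArcs P Q δ) {x : ℝ}
    (hx : IsGoodSlice φ F x) (hpos : 0 < F x) :
    ¬ (TopAccumulates φ F x P ∧ TopAccumulates φ F x Q) := by
  rintro ⟨hP, hQ⟩
  obtain ⟨r, hr, hsmall⟩ := exists_pos_setLIntegral_lt_of_measure_lt hx.2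
    (ENNReal.ofReal_pos.2 (half_pos hPQ.pos)).ne'
  obtain ⟨s, -, hs0, hs⟩ := ENNReal.lt_iff_exists_real_btwn.1 hr
  have hspos : 0 < s := ENNReal.ofReal_pos.1 hs0
  -- The upper end has small measure because `F x` is finite; the maximum covers slices shorter than
  -- `s`.
  set κ := max 0 ((F x).toReal - s) with hκ
  have hFx : 0 < (F x).toReal := ENNReal.toReal_pos hpos.ne' hx.1
  have hκF : ENNReal.ofReal κ < F x := by
    rw [ENNReal.ofReal_lt_iff_lt_toReal (le_max_left _ _) hx.1]
    exact max_lt hFx (by linarith)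
  have hJeq : heightSet (F x) ∩ Ioi κ = Ioo κ (F x).toReal := by
    ext y
    constructor
    · rintro ⟨⟨hy0, hy⟩, hy1⟩
      exact ⟨hy1, (ENNReal.ofReal_lt_iff_lt_toReal hy0.le hx.1).1 hy⟩
    · rintro ⟨hy1, hy2⟩
      have hy0 : 0 < y := (le_max_left _ _).trans_lt hy1
      exact ⟨⟨hy0, (ENNReal.ofReal_lt_iff_lt_toReal hy0.le hx.1).2 hy2⟩, hy1⟩
  have hsub : Ioo κ (F x).toReal ⊆ heightSet (F x) := by
    rw [← hJeq]; exact inter_subset_left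
  have hJ : ∀ R, TopAccumulates φ F x R →
      Accumulates φ {z | z.re = x ∧ z.im ∈ Ioo κ (F x).toReal} R := by
    intro R hR
    refine (hR κ hκF).mono' hφ ?_
    rintro z hz ⟨rfl, hz2⟩
    exact ⟨rfl, by rw [← hJeq]; exact ⟨mem_graphDomain_bot_top.1 hz, hz2⟩⟩
  refine not_accumulates_both_of_lintegral_lt hφ hPQ ordConnected_Ioo hsub ?_ ⟨hJ P hP, hJ Q hQ⟩
  have := hsmall (Ioo κ (F x).toReal) ((Measure.restrict_apply_le _ _).trans_lt (by
    rw [Real.volume_Ioo]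
    refine lt_of_le_of_lt (ENNReal.ofReal_le_ofReal ?_) hs
    linarith [le_max_right 0 ((F x).toReal - s)]))
  rwa [Measure.restrict_restrict measurableSet_Ioo, inter_eq_left.2 hsub] at this

/-- Over an interval of slices joining `P` to `Q`, all good slices have the same orientation. -/
theorem slices_orientation (hF : LowerSemicontinuous F) (hPQ : SeparatedArcs P Q δ) {p q : ℝ}
    (hP : ∀ x ∈ Ioo p q, Accumulates φ {z | z.re = x} P)
    (hQ : ∀ x ∈ Ioo p q, Accumulates φ {z | z.re = x} Q) :
    (∀ x ∈ Ioo p q, IsGoodSlice φ F x → ¬ TopAccumulates φ F x P ∧ ¬ BottomAccumulates φ x Q) ∨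
    (∀ x ∈ Ioo p q, IsGoodSlice φ F x → ¬ TopAccumulates φ F x Q ∧ ¬ BottomAccumulates φ x P) := by
  -- Each arc is reached at some end and no end reaches both, so one end belongs to `P` and the
  -- other to `Q`.
  have htype : ∀ x ∈ Ioo p q, IsGoodSlice φ F x →
      (BottomAccumulates φ x P ∧ TopAccumulates φ F x Q ∧
        ¬ TopAccumulates φ F x P ∧ ¬ BottomAccumulates φ x Q) ∨
      (BottomAccumulates φ x Q ∧ TopAccumulates φ F x P ∧
        ¬ TopAccumulates φ F x Q ∧ ¬ BottomAccumulates φ x P) := by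
    intro x hx hg
    have hpos := pos_of_accumulates hφ (hP x hx)
    have h1 := hg.not_bottomAccumulates_both hφ hPQ hpos
    have h2 := hg.not_topAccumulates_both hφ hPQ hpos
    have h3 := bottom_or_top_of_accumulates hφ hPQ.left_subset hpos (hP x hx)
    have h4 := bottom_or_top_of_accumulates hφ hPQ.right_subset hpos (hQ x hx)
    tauto
  by_contra! hcon
  obtain ⟨⟨x, hx, hgx, hx'⟩, y, hy, hgy, hy'⟩ := hcon
  have hQP : BottomAccumulates φ x Q ∧ TopAccumulates φ F x P ∧
        ¬ TopAccumulates φ F x Q ∧ ¬ BottomAccumulates φ x P := by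
    have := htype x hx hgx
    tauto
  have hPQ' : BottomAccumulates φ y P ∧ TopAccumulates φ F y Q ∧
        ¬ TopAccumulates φ F y P ∧ ¬ BottomAccumulates φ y Q := by
    have := htype y hy hgy
    tauto
  have hpos : ∀ s ∈ Ioo p q, ∀ t ∈ Ioo p q, ∀ r ∈ Icc s t, 0 < F r := fun s hs t ht r hr =>
    pos_of_accumulates hφ (hP r (Icc_subset_Ioo hs.1 ht.2 hr))
  -- For opposite orientations, apply the staircase argument to the arc reached by the lower end of
  -- the left slice and the upper end of the right one.
  rcases lt_trichotomy x y with h | h | h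
  · have := topAccumulates_or_bottomAccumulates hφ hF hPQ.right_subset hPQ.right.isPreconnected h
      (hpos x hx y hy) hQP.1 hPQ'.2.1
    tauto
  · subst h
    tauto
  · have := topAccumulates_or_bottomAccumulates hφ hF hPQ.left_subset hPQ.left.isPreconnected h
      (hpos y hy x hx) hPQ'.1 hQP.2.1
    tauto

/-- A set in a strip of slices joining `P` to `Q` which accumulates at both arcs meets every graph
in the strip. -/
theorem exists_le_and_exists_ge_graph (hF : LowerSemicontinuous F) (hPQ : SeparatedArcs P Q δ)
    {p q : ℝ} (hP : ∀ x ∈ Ioo p q, Accumulates φ {z | z.re = x} P)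
    (hQ : ∀ x ∈ Ioo p q, Accumulates φ {z | z.re = x} Q) {x₁ x₂ : ℝ} (hx₁ : x₁ ∈ Ioo p q)
    (hx₂ : x₂ ∈ Ioo p q) (hg₁ : IsGoodSlice φ F x₁) (hg₂ : IsGoodSlice φ F x₂) (h12 : x₁ ≤ x₂)
    {g : ℝ → ℝ} (hg : Continuous g) (hg0 : ∀ x ∈ Icc x₁ x₂, 0 < g x)
    (hgF : ∀ x ∈ Icc x₁ x₂, ENNReal.ofReal (g x) < F x) {E : Set ℂ}
    (hE : ∀ z ∈ E, x₁ < z.re ∧ z.re < x₂) (hEP : Accumulates φ E P) (hEQ : Accumulates φ E Q) :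
    (∃ z ∈ E, z.im ≤ g z.re) ∧ ∃ z ∈ E, g z.re ≤ z.im := by
  obtain ⟨x₃, h23, h3q⟩ := exists_between hx₂.2
  have hx₃ : x₃ ∈ Ioo p q := ⟨hx₂.1.trans h23, h3q⟩
  have habove : ∀ R : Set ℂ, R ⊆ sphere 0 1 → IsPreconnected R → Accumulates φ E R →
      Accumulates φ {z | z.re = x₃} R → ¬ TopAccumulates φ F x₁ R → ¬ TopAccumulates φ F x₂ R →
      ∃ z ∈ E, z.im ≤ g z.re := by
    intro R hR hRc hER h3R n1 n2
    by_contra! hcon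
    exact (topAccumulates_of_above_graph hφ hR hRc h12 h23 hg hg0 hgF
      (fun z hz => ⟨(hE z hz).1, (hE z hz).2, hcon z hz⟩) hER h3R).elim n1 n2
  have hbelow : ∀ R : Set ℂ, R ⊆ sphere 0 1 → IsPreconnected R → Accumulates φ E R →
      Accumulates φ {z | z.re = x₃} R → ¬ BottomAccumulates φ x₁ R → ¬ BottomAccumulates φ x₂ R →
      ∃ z ∈ E, g z.re ≤ z.im := by
    intro R hR hRc hER h3R n1 n2
    by_contra! hcon
    exact (bottomAccumulates_of_below_graph hφ hR hRc h12 h23 hg hg0 hgF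
      (fun z hz => ⟨(hE z hz).1, (hE z hz).2, hcon z hz⟩) hER h3R).elim n1 n2
  -- The arc that is never reached by upper ends rules out a set lying above the graph; the arc
  -- never reached by lower ends rules out one lying below.
  rcases slices_orientation hφ hF hPQ hP hQ with h | h
  · exact ⟨habove P hPQ.left_subset hPQ.left.isPreconnected hEP (hP x₃ hx₃) (h x₁ hx₁ hg₁).1
        (h x₂ hx₂ hg₂).1,
      hbelow Q hPQ.right_subset hPQ.right.isPreconnected hEQ (hQ x₃ hx₃) (h x₁ hx₁ hg₁).2
        (h x₂ hx₂ hg₂).2⟩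
  · exact ⟨habove Q hPQ.right_subset hPQ.right.isPreconnected hEQ (hQ x₃ hx₃) (h x₁ hx₁ hg₁).1
        (h x₂ hx₂ hg₂).1,
      hbelow P hPQ.left_subset hPQ.left.isPreconnected hEP (hP x₃ hx₃) (h x₁ hx₁ hg₁).2
        (h x₂ hx₂ hg₂).2⟩

end GoodSlices

/-! ### Vertical scaling and the lower bound for the modulus. -/

theorem strictLipschitzAt_of_forall_dist_le {G : ℂ → ℝ} {c : ℝ} (hc : 0 ≤ c)
    (h : ∀ w w', dist (G w) (G w') ≤ c * dist w w') (z : ℂ) : StrictLipschitzAt G c z :=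
  ⟨hc, fun _ hη => ⟨univ, univ_mem, fun w _ w' _ => (h w w').trans
    (mul_le_mul_of_nonneg_right (by linarith) dist_nonneg)⟩⟩

theorem strictLipschitzAt_const_mul_im {c : ℝ} (hc : 0 ≤ c) (z : ℂ) :
    StrictLipschitzAt (fun w => c * w.im) c z := by
  refine strictLipschitzAt_of_forall_dist_le hc (fun w w' => ?_) z
  rw [Real.dist_eq, ← mul_sub, abs_mul, abs_of_nonneg hc, ← Complex.sub_im, dist_eq_norm]
  exact mul_le_mul_of_nonneg_left (Complex.abs_im_le_norm _) hc

theorem strictLipschitzAt_const_mul_re {c : ℝ} (hc : 0 ≤ c) (z : ℂ) :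
    StrictLipschitzAt (fun w => c * w.re) c z := by
  refine strictLipschitzAt_of_forall_dist_le hc (fun w w' => ?_) z
  rw [Real.dist_eq, ← mul_sub, abs_mul, abs_of_nonneg hc, ← Complex.sub_re, dist_eq_norm]
  exact mul_le_mul_of_nonneg_left (Complex.abs_re_le_norm _) hc

theorem curveModulus_mono {Γ₁ Γ₂ : Set PlaneCurve} (h : Γ₁ ⊆ Γ₂) :
    curveModulus Γ₁ ≤ curveModulus Γ₂ :=
  le_iInf₂ fun ρ hρ => iInf₂_le ρ ⟨hρ.1, fun γ hγ => hρ.2 γ (h hγ)⟩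

theorem curveModulus_le {Γ : Set PlaneCurve} {ρ : ℂ → ℝ≥0∞} (h : IsAdmissible Γ ρ) :
    curveModulus Γ ≤ ∫⁻ z, ρ z ^ 2 := iInf₂_le ρ h

theorem PlaneCurve.map_verticalScaling_one (γ : PlaneCurve) :
    PlaneCurve.map (verticalScaling 1) γ = γ := by
  have : ∀ z, verticalScaling 1 z = z := fun z => by
    rw [verticalScaling_apply, one_mul]
  simp [PlaneCurve.map, this]

theorem PlaneCurve.map_verticalScaling_vertical (x ε : ℝ) (h : ℝ≥0∞) :
    PlaneCurve.map (verticalScaling ε) (PlaneCurve.vertical x 1 h) = PlaneCurve.vertical x ε h := by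
  simp [PlaneCurve.map, PlaneCurve.vertical, verticalScaling_apply]

theorem dist_verticalScaling_inv_le {ε : ℝ} (hε : 0 < ε) (hε1 : ε ≤ 1) (w w' : ℂ) :
    dist (verticalScaling ε⁻¹ w) (verticalScaling ε⁻¹ w') ≤ ε⁻¹ * dist w w' := by
  have h1 : 1 ≤ ε⁻¹ := (one_le_inv₀ hε).2 hε1
  rw [verticalScaling_apply, verticalScaling_apply, Complex.dist_eq_re_im, Complex.dist_eq_re_im]
  refine Real.sqrt_le_iff.2 ⟨by positivity, ?_⟩
  rw [mul_pow, Real.sq_sqrt (by positivity)]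
  have h2 : 1 ≤ ε⁻¹ ^ 2 := one_le_pow₀ h1
  have h3 := mul_le_mul_of_nonneg_right h2 (sq_nonneg (w.re - w'.re))
  nlinarith

theorem verticalScaling_inv_verticalScaling {ε : ℝ} (hε : ε ≠ 0) (z : ℂ) :
    verticalScaling ε⁻¹ (verticalScaling ε z) = z := by
  rw [verticalScaling_apply, verticalScaling_apply]
  apply Complex.ext <;> simp [hε]

theorem lintegral_sq_le {α : Type*} [MeasurableSpace α] (μ : Measure α) {h : α → ℝ≥0∞}
    (hh : AEMeasurable h μ) : (∫⁻ a, h a ∂μ) ^ 2 ≤ μ univ * ∫⁻ a, h a ^ 2 ∂μ := by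
  have := ENNReal.lintegral_mul_le_Lp_mul_Lq μ Real.HolderConjugate.two_two
    (f := fun _ => (1 : ℝ≥0∞)) aemeasurable_const hh
  simp only [Pi.mul_apply, one_mul, ENNReal.rpow_two, one_pow, lintegral_one] at this
  calc (∫⁻ a, h a ∂μ) ^ 2 ≤ (μ univ ^ (1 / 2 : ℝ) * (∫⁻ a, h a ^ 2 ∂μ) ^ (1 / 2 : ℝ)) ^ 2 := by
        gcongr
    _ = μ univ * ∫⁻ a, h a ^ 2 ∂μ := by
        rw [mul_pow, ← ENNReal.rpow_natCast, ← ENNReal.rpow_natCast, ← ENNReal.rpow_mul,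
          ← ENNReal.rpow_mul]
        norm_num

/-- A family containing the vertical segments of height `ε F(x)` for `p < x < q` has modulus at
least `ε⁻¹ ∫_p^q dx / F(x)`. -/
theorem lintegral_inv_le_curveModulus {F : ℝ → ℝ≥0∞} {p q ε : ℝ} (hε : 0 < ε) {Γ : Set PlaneCurve}
    (hΓ : ∀ x ∈ Ioo p q, PlaneCurve.vertical x ε (F x) ∈ Γ) :
    ∫⁻ x in Ioo p q, (F x)⁻¹ ≤ ENNReal.ofReal ε * curveModulus Γ := by
  have hε0 : ENNReal.ofReal ε ≠ 0 := (ENNReal.ofReal_pos.2 hε).ne'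
  have hεt : ENNReal.ofReal ε ≠ ∞ := ENNReal.ofReal_ne_top
  suffices h : (ENNReal.ofReal ε)⁻¹ * ∫⁻ x in Ioo p q, (F x)⁻¹ ≤ curveModulus Γ by
    calc ∫⁻ x in Ioo p q, (F x)⁻¹
        = ENNReal.ofReal ε * ((ENNReal.ofReal ε)⁻¹ * ∫⁻ x in Ioo p q, (F x)⁻¹) := by
          rw [← mul_assoc, ENNReal.mul_inv_cancel hε0 hεt, one_mul]
      _ ≤ _ := by gcongr
  refine le_iInf₂ fun ρ hρ => ?_
  have hsq : Measurable fun z => ρ z ^ 2 := hρ.1.pow_const 2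
  have hinner : Measurable fun x : ℝ => ∫⁻ y : ℝ, ρ ⟨x, y⟩ ^ 2 :=
    (hsq.comp Complex.measurableEquivRealProd.symm.measurable).lintegral_prod_right'
  -- Cauchy–Schwarz on a segment of length `ε F(x)`, whose `ρ`-length is at least `1`.
  have key : ∀ x ∈ Ioo p q, (F x)⁻¹ ≤ ENNReal.ofReal ε * ∫⁻ y : ℝ, ρ ⟨x, y⟩ ^ 2 := by
    intro x hx
    rcases eq_or_ne (F x) ∞ with hF | hF
    · simp [hF]
    have h1 := (hρ.2 _ (hΓ x hx)).trans (PlaneCurve.lineIntegral_vertical_le x hε (F x) ρ)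
    set H := {y : ℝ | 0 < y ∧ ENNReal.ofReal (y / ε) < F x} with hH
    have hHv : volume H ≤ ENNReal.ofReal ε * F x := by
      have hsub : H ⊆ Ioo 0 (ε * (F x).toReal) := by
        rintro y ⟨hy0, hy⟩
        refine ⟨hy0, ?_⟩
        rw [ENNReal.ofReal_lt_iff_lt_toReal (div_pos hy0 hε).le hF, div_lt_iff₀ hε] at hy
        linarith
      refine (measure_mono hsub).trans ?_
      rw [Real.volume_Ioo, sub_zero, ENNReal.ofReal_mul hε.le, ENNReal.ofReal_toReal hF]
    have hmeas : Measurable fun y : ℝ => ρ ⟨x, y⟩ :=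
      hρ.1.comp (Complex.measurableEquivRealProd.symm.measurable.comp measurable_prodMk_left)
    have h2 : 1 ≤ F x * (ENNReal.ofReal ε * ∫⁻ y : ℝ, ρ ⟨x, y⟩ ^ 2) := by
      calc (1 : ℝ≥0∞) ≤ (∫⁻ y in H, ρ ⟨x, y⟩) ^ 2 := one_le_pow₀ h1
        _ ≤ volume.restrict H univ * ∫⁻ y in H, ρ ⟨x, y⟩ ^ 2 :=
          lintegral_sq_le _ hmeas.aemeasurable
        _ ≤ (ENNReal.ofReal ε * F x) * ∫⁻ y : ℝ, ρ ⟨x, y⟩ ^ 2 := by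
          rw [Measure.restrict_apply_univ]
          gcongr
          exact Measure.restrict_le_self
        _ = _ := by ring
    rw [mul_comm] at h2
    rcases eq_or_ne (F x) 0 with hF0 | hF0
    · simp [hF0] at h2
    · rw [← one_div]
      exact (ENNReal.div_le_iff hF0 hF).2 h2
  calc (ENNReal.ofReal ε)⁻¹ * ∫⁻ x in Ioo p q, (F x)⁻¹
      ≤ (ENNReal.ofReal ε)⁻¹ * ∫⁻ x in Ioo p q, ENNReal.ofReal ε * ∫⁻ y : ℝ, ρ ⟨x, y⟩ ^ 2 := by
        gcongr 1
        exact setLIntegral_mono' measurableSet_Ioo key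
    _ = ∫⁻ x in Ioo p q, ∫⁻ y : ℝ, ρ ⟨x, y⟩ ^ 2 := by
        rw [lintegral_const_mul _ hinner, ← mul_assoc, ENNReal.inv_mul_cancel hε0 hεt, one_mul]
    _ ≤ ∫⁻ x : ℝ, ∫⁻ y : ℝ, ρ ⟨x, y⟩ ^ 2 := setLIntegral_le_lintegral _ _
    _ = ∫⁻ z, ρ z ^ 2 := (lintegral_complex_eq_lintegral_lintegral hsq).symm

/-! ### The modulus of the vertical segments. -/

section GraphDomainCurves

variable {φ : ℂ → ℂ} {F : ℝ → ℝ≥0∞} {P Q : Set ℂ} {δ : ℝ}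

theorem trace_vertical_one (x : ℝ) :
    (PlaneCurve.vertical x 1 (F x)).trace = {z | z.re = x} ∩ graphDomain ⊥ ⊤ F := by
  ext z
  simp only [PlaneCurve.trace, PlaneCurve.vertical, one_mul, mem_image, mem_ofPred_eq, mem_inter_iff,
    mem_graphDomain_bot_top]
  constructor
  · rintro ⟨t, ht, rfl⟩
    exact ⟨rfl, ht⟩
  · rintro ⟨rfl, h⟩
    exact ⟨z.im, h, rfl⟩

variable (hφ : IsRiemannMap φ (graphDomain ⊥ ⊤ F)) (hPQ : SeparatedArcs P Q δ)
include hφ hPQ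

theorem vertical_mem_verticalSegments {x : ℝ} (hP : Accumulates φ {z | z.re = x} P)
    (hQ : Accumulates φ {z | z.re = x} Q) : PlaneCurve.vertical x 1 (F x) ∈
      verticalSegments (connectingCurves φ (graphDomain ⊥ ⊤ F) P Q) := by
  have ht := trace_vertical_one (F := F) x
  refine ⟨mem_connectingCurves hφ hPQ ?_ ?_ ?_, ?_, x, ?_⟩
  · rw [ht]; exact inter_subset_right
  · rw [ht]; exact hP.inter_domain hφ
  · rw [ht]; exact hQ.inter_domain hφ
  · intro s _ t _ hst
    simpa [PlaneCurve.vertical] using hst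
  · rw [ht]; exact fun z hz => hz.1

/-- A segment of the family is part of a slice; conversely the full slice, once it accumulates at
both arcs, is itself in the family. -/
theorem mem_xCoordinates_iff {x : ℝ} :
    x ∈ xCoordinates (verticalSegments (connectingCurves φ (graphDomain ⊥ ⊤ F) P Q)) ↔
      Accumulates φ {z | z.re = x} P ∧ Accumulates φ {z | z.re = x} Q := by
  constructor
  · rintro ⟨γ, ⟨hγ, -, x', hx'⟩, z, hz, rfl⟩
    have : γ.trace ⊆ {w | w.re = z.re} := fun w hw => (hx' w hw).trans (hx' z hz).symm
    exact ⟨(accumulates_of_mem_connectingCurves hPQ hγ).mono this,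
      (accumulates_right_of_mem_connectingCurves hPQ hγ).mono this⟩
  · rintro ⟨hP, hQ⟩
    obtain ⟨ζ, -, h⟩ := hP.exists_dist_lt hφ
    obtain ⟨z, hz, -⟩ := h 1 one_pos
    refine ⟨_, vertical_mem_verticalSegments hφ hPQ hP hQ, z, ?_, hz.1⟩
    rw [trace_vertical_one]
    exact hz

/-- A curve joining `P` to `Q` has length at least `1` for a metric dominating the pull-back of
the metric `|dw| / δ` of the disk. -/
theorem one_le_lineIntegral_of_pullback {γ : PlaneCurve}
    (hγ : γ ∈ connectingCurves φ (graphDomain ⊥ ⊤ F) P Q) {ε : ℝ} (hε : 0 < ε) (hε1 : ε ≤ 1)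
    {ρ : ℂ → ℝ≥0∞} (hρ : ∀ z ∈ γ.trace,
      ENNReal.ofReal (‖deriv (diskInverse φ) z‖ / (δ * ε)) ≤ ρ (verticalScaling ε z)) :
    1 ≤ (PlaneCurve.map (verticalScaling ε) γ).lineIntegral ρ := by
  have hδ := hPQ.pos
  obtain ⟨ζ, hζ, h1⟩ := (accumulates_of_mem_connectingCurves hPQ hγ).exists_dist_lt hφ
  obtain ⟨ζ', hζ', h2⟩ := (accumulates_right_of_mem_connectingCurves hPQ hγ).exists_dist_lt hφ
  -- Along the curve `G` comes close to `0` near `ζ` in `P` and gets nearly as large as `1`, or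
  -- larger, near `ζ'` in `Q`. Undoing the scaling costs the factor `1/ε`.
  set G : ℂ → ℝ := fun z => δ⁻¹ * dist (diskInverse φ (verticalScaling ε⁻¹ z)) ζ with hG
  have hlip : ∀ z ∈ (PlaneCurve.map (verticalScaling ε) γ).trace,
      ∃ c, ENNReal.ofReal c ≤ ρ z ∧ StrictLipschitzAt G c z := by
    rintro _ ⟨t, ht, rfl⟩
    have hz : γ.toFun t ∈ γ.trace := ⟨t, ht, rfl⟩
    refine ⟨_, hρ _ hz, ?_⟩
    have e : verticalScaling ε⁻¹ (verticalScaling ε (γ.toFun t)) = γ.toFun t :=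
      verticalScaling_inv_verticalScaling hε.ne' _
    have h3 := (hφ.strictLipschitzAt_dist (hγ.1 hz) ζ)
    rw [← e] at h3
    have h4 := h3.comp_lipschitzWith (L := verticalScaling ε⁻¹) (inv_pos.2 hε)
      (dist_verticalScaling_inv_le hε hε1)
    rw [e] at h4
    refine ⟨by positivity, fun η hη => ?_⟩
    obtain ⟨N, hN, h5⟩ := h4.2 (η * δ) (by positivity)
    refine ⟨N, hN, fun w hw w' hw' => ?_⟩
    have h6 := h5 w hw w' hw'
    simp only [Function.comp_apply, Real.dist_eq] at h6
    rw [Real.dist_eq, hG, ← mul_sub, abs_mul, abs_of_pos (inv_pos.2 hδ)]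
    calc _ ≤ δ⁻¹ * ((‖deriv (diskInverse φ) (γ.toFun t)‖ * ε⁻¹ + η * δ) * dist w w') := by
          gcongr
      _ = _ := by field_simp
  refine le_of_forall_lt fun a ha => ?_
  obtain ⟨κ, hκ0, hκ⟩ : ∃ κ > 0, a < ENNReal.ofReal (1 - κ) := by
    obtain ⟨b, hb0, hab, hb⟩ := ENNReal.lt_iff_exists_real_btwn.1 ha
    refine ⟨1 - b, ?_, by simpa using hab⟩
    have := ENNReal.ofReal_lt_one.1 hb
    linarith
  obtain ⟨_, ⟨⟨s, hs, rfl⟩, -⟩, hz⟩ := h1 (δ * (κ / 2)) (by positivity)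
  obtain ⟨_, ⟨⟨t, ht, rfl⟩, -⟩, hz'⟩ := h2 (δ * (κ / 2)) (by positivity)
  have h7 := (PlaneCurve.map (verticalScaling ε) γ).edist_le_lineIntegral hlip hs ht
  refine hκ.trans_le (le_trans ?_ h7)
  rw [edist_dist]
  refine ENNReal.ofReal_le_ofReal ?_
  simp only [hG, PlaneCurve.map, verticalScaling_inv_verticalScaling hε.ne']
  have h8 := hPQ.le_dist ζ hζ ζ' hζ'
  have h9 := dist_triangle_left ζ ζ' (diskInverse φ (γ.toFun t))
  rw [Real.dist_eq, ← mul_sub, abs_mul, abs_of_pos (inv_pos.2 hδ)]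
  have h10 : δ * (1 - κ) ≤ |dist (diskInverse φ (γ.toFun s)) ζ -
      dist (diskInverse φ (γ.toFun t)) ζ| := by
    rw [abs_sub_comm]
    refine le_trans ?_ (le_abs_self _)
    linarith
  calc 1 - κ = δ⁻¹ * (δ * (1 - κ)) := by field_simp
    _ ≤ _ := by gcongr

theorem curveModulus_connectingCurves_lt_top :
    curveModulus (connectingCurves φ (graphDomain ⊥ ⊤ F) P Q) < ∞ := by
  set D := graphDomain ⊥ ⊤ F
  have hδ := hPQ.pos
  set ρ : ℂ → ℝ≥0∞ := D.indicator fun z => ENNReal.ofReal δ⁻¹ * ‖deriv (diskInverse φ) z‖ₑ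
  have hm : Measurable fun z => ‖deriv (diskInverse φ) z‖ₑ := (measurable_deriv _).enorm
  have hadm : IsAdmissible (connectingCurves φ D P Q) ρ := by
    refine ⟨(hm.const_mul _).indicator hφ.isOpen.measurableSet, fun γ hγ => ?_⟩
    have := one_le_lineIntegral_of_pullback hφ hPQ hγ one_pos le_rfl (ρ := ρ) (by
      intro z hz
      rw [verticalScaling_apply, one_mul]
      change _ ≤ D.indicator _ z
      rw [indicator_of_mem (hγ.1 hz), mul_one, div_eq_inv_mul,
        ENNReal.ofReal_mul (inv_pos.2 hδ).le, ofReal_norm])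
    rwa [PlaneCurve.map_verticalScaling_one] at this
  refine (curveModulus_le hadm).trans_lt ?_
  have : ∀ z, ρ z ^ 2 = D.indicator (fun z => ENNReal.ofReal δ⁻¹ ^ 2 *
      ‖deriv (diskInverse φ) z‖ₑ ^ 2) z := by
    intro z
    by_cases hz : z ∈ D
    · simp [ρ, hz, mul_pow]
    · simp [ρ, hz]
  simp only [this]
  rw [lintegral_indicator hφ.isOpen.measurableSet, lintegral_const_mul _ (hm.pow_const 2)]
  exact ENNReal.mul_lt_top (by simp) hφ.lintegral_enorm_deriv_diskInverse_sq_lt_top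

/-- The metric is `1/F` on the part of `D` over `(p, q)`, and `∞` over a null set of positions,
where admissibility then costs no energy. -/
theorem curveModulus_verticalSegments_le (hF : Measurable F)
    (harea : volume (graphDomain ⊥ ⊤ F) < ∞) {p q : ℝ}
    (hX : xCoordinates (verticalSegments (connectingCurves φ (graphDomain ⊥ ⊤ F) P Q)) ⊆ Icc p q) :
    curveModulus (verticalSegments (connectingCurves φ (graphDomain ⊥ ⊤ F) P Q)) ≤
      ∫⁻ x in Ioo p q, (F x)⁻¹ := by
  classical
  set D := graphDomain ⊥ ⊤ F
  -- A measurable hull, to keep the metric Borel.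
  set N := toMeasurable volume ({x | ¬ IsGoodSlice φ F x} ∪ {p, q}) with hN
  have hNm : MeasurableSet N := measurableSet_toMeasurable _ _
  have hN0 : volume N = 0 := by
    rw [hN, measure_toMeasurable, measure_union_null_iff]
    exact ⟨ae_isGoodSlice hφ hF harea, (toFinite {p, q}).measure_zero _⟩
  have hNsub := subset_toMeasurable volume ({x | ¬ IsGoodSlice φ F x} ∪ {p, q})
  rw [← hN] at hNsub
  set ρ : ℂ → ℝ≥0∞ := ({z | z.re ∈ N} ∪ {z | z.re ∈ Ioo p q} ∩ D).indicator
    fun z => if z.re ∈ N then ∞ else (F z.re)⁻¹ with hρdef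
  have hre := Complex.measurable_re
  have hSm : MeasurableSet ({z : ℂ | z.re ∈ N} ∪ {z | z.re ∈ Ioo p q} ∩ D) :=
    (hre hNm).union ((hre measurableSet_Ioo).inter hφ.isOpen.measurableSet)
  have hρm : Measurable ρ :=
    (Measurable.ite (hre hNm) measurable_const (hF.comp hre).inv).indicator hSm
  have hadm : IsAdmissible (verticalSegments (connectingCurves φ D P Q)) ρ := by
    refine ⟨hρm, fun γ hγ => ?_⟩
    obtain ⟨hγΓ, -, x, hx⟩ := id hγ
    have hP := accumulates_of_mem_connectingCurves hPQ hγΓ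
    have hQ := accumulates_right_of_mem_connectingCurves hPQ hγΓ
    have key : ∀ c : ℝ, 0 ≤ c → (∀ z ∈ γ.trace, ENNReal.ofReal c ≤ ρ z) →
        ∀ z ∈ γ.trace, ∀ z' ∈ γ.trace, ENNReal.ofReal (c * (z'.im - z.im)) ≤ γ.lineIntegral ρ := by
      rintro c hc hcρ _ ⟨s, hs, rfl⟩ _ ⟨t, ht, rfl⟩
      refine le_trans ?_ (γ.edist_le_lineIntegral
        (fun z hz => ⟨c, hcρ z hz, strictLipschitzAt_const_mul_im hc z⟩) hs ht)
      rw [edist_comm, edist_dist, Real.dist_eq, ← mul_sub]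
      exact ENNReal.ofReal_le_ofReal (le_abs_self _)
    obtain ⟨z₀, hz₀⟩ : γ.trace.Nonempty := by
      obtain ⟨ζ, -, h⟩ := hP.exists_dist_lt hφ
      obtain ⟨z, hz, -⟩ := h 1 one_pos
      exact ⟨z, hz.1⟩
    by_cases hxN : x ∈ N
    · have hρtop : ∀ z ∈ γ.trace, ρ z = ∞ := by
        intro z hz
        have : z.re ∈ N := by rwa [hx z hz]
        simp [hρdef, this]
      -- Two distinct points make the length for the metric `∞` at least `1`; a single point is
      -- compact and would not accumulate.
      obtain ⟨z₁, hz₁, hne⟩ : ∃ z₁ ∈ γ.trace, z₁ ≠ z₀ := by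
        by_contra! hcon
        have : γ.trace ⊆ {z₀} := hcon
        exact Accumulates.not_of_isCompact hφ hPQ.left_subset isCompact_singleton
          (singleton_subset_iff.2 (hγΓ.1 hz₀)) (hP.mono this)
      have him : z₁.im - z₀.im ≠ 0 := by
        intro h
        exact hne (Complex.ext ((hx z₁ hz₁).trans (hx z₀ hz₀).symm) (sub_eq_zero.1 h))
      rcases lt_or_gt_of_ne him with h | h
      · have := key (z₀.im - z₁.im)⁻¹ (inv_nonneg.2 (by linarith))
          (fun z hz => by simp [hρtop z hz]) z₁ hz₁ z₀ hz₀
        rwa [inv_mul_cancel₀ (by linarith), ENNReal.ofReal_one] at this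
      · have := key (z₁.im - z₀.im)⁻¹ (inv_nonneg.2 h.le)
          (fun z hz => by simp [hρtop z hz]) z₀ hz₀ z₁ hz₁
        rwa [inv_mul_cancel₀ him, ENNReal.ofReal_one] at this
    · have hxI : x ∈ Ioo p q := by
        have h1 := hX ⟨γ, hγ, z₀, hz₀, hx z₀ hz₀⟩
        have h2 : x ≠ p := fun h => hxN (hNsub (Or.inr (Or.inl h)))
        have h3 : x ≠ q := fun h => hxN (hNsub (Or.inr (Or.inr h)))
        exact ⟨lt_of_le_of_ne h1.1 h2.symm, lt_of_le_of_ne h1.2 h3⟩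
      have hgood : IsGoodSlice φ F x := by
        by_contra h
        exact hxN (hNsub (Or.inl h))
      have hpos : 0 < F x := pos_of_accumulates hφ (hP.mono hx)
      set h := (F x).toReal
      have hh : 0 < h := ENNReal.toReal_pos hpos.ne' hgood.1
      have hFh : F x = ENNReal.ofReal h := (ENNReal.ofReal_toReal hgood.1).symm
      have hρc : ∀ z ∈ γ.trace, ENNReal.ofReal h⁻¹ ≤ ρ z := by
        intro z hz
        have h1 : z.re = x := hx z hz
        have h2 : z ∈ {z : ℂ | z.re ∈ N} ∪ {z | z.re ∈ Ioo p q} ∩ D :=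
          Or.inr ⟨by rw [mem_ofPred_eq, h1]; exact hxI, hγΓ.1 hz⟩
        rw [hρdef, indicator_of_mem h2, h1, if_neg hxN, hFh, ENNReal.ofReal_inv_of_pos hh]
      -- A segment staying above `κ` would make the upper end of a good slice accumulate at both
      -- arcs; hence the segment fills the slice.
      have hlow : ∀ κ, 0 < κ → ∃ z ∈ γ.trace, z.im < κ := by
        intro κ hκ
        by_contra! hcon
        refine hgood.not_topAccumulates_both hφ hPQ hpos ⟨?_, ?_⟩
        · exact topAccumulates_of_accumulates hφ hPQ.left_subset hκ
            (hP.mono fun z hz => ⟨hx z hz, hcon z hz⟩)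
        · exact topAccumulates_of_accumulates hφ hPQ.right_subset hκ
            (hQ.mono fun z hz => ⟨hx z hz, hcon z hz⟩)
      have hhigh : ∀ κ, κ < h → ∃ z ∈ γ.trace, κ < z.im := by
        intro κ hκ
        by_contra! hcon
        have hκF : ENNReal.ofReal κ < F x := by
          rw [hFh]; exact (ENNReal.ofReal_lt_ofReal_iff hh).2 hκ
        refine hgood.not_bottomAccumulates_both hφ hPQ hpos ⟨?_, ?_⟩
        · exact bottomAccumulates_of_accumulates hφ hPQ.left_subset hκF
            (hP.mono fun z hz => ⟨hx z hz, hcon z hz⟩)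
        · exact bottomAccumulates_of_accumulates hφ hPQ.right_subset hκF
            (hQ.mono fun z hz => ⟨hx z hz, hcon z hz⟩)
      refine le_of_forall_lt fun a ha => ?_
      obtain ⟨b, hb0, hab, hb⟩ := ENNReal.lt_iff_exists_real_btwn.1 ha
      have hb1 : b < 1 := ENNReal.ofReal_lt_one.1 hb
      obtain ⟨z, hz, hzκ⟩ := hlow (h * ((1 - b) / 2)) (mul_pos hh (by linarith))
      obtain ⟨z', hz', hzκ'⟩ := hhigh (h * ((1 + b) / 2)) (by nlinarith)
      refine hab.trans_le (le_trans (ENNReal.ofReal_le_ofReal ?_)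
        (key h⁻¹ (inv_pos.2 hh).le hρc z hz z' hz'))
      calc b = h⁻¹ * (h * b) := by field_simp
        _ ≤ _ := by
          gcongr
          linarith
  refine (curveModulus_le hadm).trans ?_
  rw [lintegral_complex_eq_lintegral_lintegral (hρm.pow_const 2),
    ← lintegral_indicator measurableSet_Ioo]
  refine lintegral_mono_ae ?_
  have hae : ∀ᵐ x, x ∉ N := measure_eq_zero_iff_ae_notMem.1 hN0
  filter_upwards [hae] with x hxN
  have hgood : IsGoodSlice φ F x := by
    by_contra h
    exact hxN (hNsub (Or.inl h))
  have hval : ∀ y : ℝ, ρ ⟨x, y⟩ ^ 2 ≤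
      (heightSet (F x)).indicator (fun _ => (Ioo p q).indicator (fun x => (F x)⁻¹) x ^ 2) y := by
    intro y
    have hD : (⟨x, y⟩ : ℂ) ∈ D ↔ y ∈ heightSet (F x) := mem_graphDomain_bot_top
    by_cases hy : (⟨x, y⟩ : ℂ) ∈ {z : ℂ | z.re ∈ N} ∪ {z | z.re ∈ Ioo p q} ∩ D
    · have h1 := hy.resolve_left hxN
      have h2 : x ∈ Ioo p q := h1.1
      rw [hρdef, indicator_of_mem hy, indicator_of_mem (hD.1 h1.2), if_neg hxN,
        indicator_of_mem h2]
    · rw [hρdef, indicator_of_notMem hy]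
      simp
  refine (lintegral_mono hval).trans ?_
  rw [lintegral_indicator (measurableSet_heightSet _), setLIntegral_const, volume_heightSet]
  by_cases hxI : x ∈ Ioo p q
  · rw [indicator_of_mem hxI]
    rcases eq_or_ne (F x) 0 with h0 | h0
    · simp [h0]
    · rw [sq, mul_assoc, ENNReal.inv_mul_cancel h0 hgood.1, mul_one]
  · simp [hxI]

end GraphDomainCurves

/-! ### The interval of positions. -/

/-- The positions of the vertical lines near which there are curves of the family. -/
def limitPositions (Γ : Set PlaneCurve) : Set ℝ :=
  {x | ∀ r > 0, ∃ γ ∈ Γ, ∀ z ∈ γ.trace, |z.re - x| < r}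

section Interval

variable {φ : ℂ → ℂ} {F : ℝ → ℝ≥0∞} {P Q : Set ℂ} {δ : ℝ}
  (hφ : IsRiemannMap φ (graphDomain ⊥ ⊤ F)) (hPQ : SeparatedArcs P Q δ)
include hφ hPQ

omit hφ hPQ in
theorem xCoordinates_verticalSegments_subset_limitPositions (Γ : Set PlaneCurve) :
    xCoordinates (verticalSegments Γ) ⊆ limitPositions Γ := by
  rintro _ ⟨γ, ⟨hγ, -, x, hx⟩, z, hz, rfl⟩ r hr
  refine ⟨γ, hγ, fun w hw => ?_⟩
  rw [hx w hw, hx z hz, sub_self, abs_zero]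
  exact hr

/-- The vertical line at `x` separates a curve near `x₀` from one near `x₁`, and both curves
accumulate at both arcs. -/
theorem mem_xCoordinates_of_between {x₀ x₁ x : ℝ}
    (h₀ : x₀ ∈ limitPositions (connectingCurves φ (graphDomain ⊥ ⊤ F) P Q))
    (h₁ : x₁ ∈ limitPositions (connectingCurves φ (graphDomain ⊥ ⊤ F) P Q))
    (hx₀ : x₀ < x) (hx₁ : x < x₁) :
    x ∈ xCoordinates (verticalSegments (connectingCurves φ (graphDomain ⊥ ⊤ F) P Q)) := by
  obtain ⟨γ₀, hγ₀, h₀⟩ := h₀ (x - x₀) (sub_pos.2 hx₀)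
  obtain ⟨γ₁, hγ₁, h₁⟩ := h₁ (x₁ - x) (sub_pos.2 hx₁)
  have h₀' : ∀ z ∈ γ₀.trace, z.re < x := fun z hz => by linarith [(abs_lt.1 (h₀ z hz)).2]
  have h₁' : ∀ z ∈ γ₁.trace, x < z.re := fun z hz => by linarith [(abs_lt.1 (h₁ z hz)).1]
  exact (mem_xCoordinates_iff hφ hPQ).2
    ⟨accumulates_slice hφ hPQ.left_subset hPQ.left.isPreconnected h₀' h₁'
      (accumulates_of_mem_connectingCurves hPQ hγ₀) (accumulates_of_mem_connectingCurves hPQ hγ₁),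
    accumulates_slice hφ hPQ.right_subset hPQ.right.isPreconnected h₀' h₁'
      (accumulates_right_of_mem_connectingCurves hPQ hγ₀)
      (accumulates_right_of_mem_connectingCurves hPQ hγ₁)⟩

/-- Integrate `1 ≤ F + 1/F`: the first term gives at most the area, the second at most the modulus.
Both being finite, the interval is bounded. -/
theorem ofReal_sub_le_of_Ioo_subset (hF : Measurable F) {a b : ℝ}
    (hab : Ioo a b ⊆ xCoordinates (verticalSegments
      (connectingCurves φ (graphDomain ⊥ ⊤ F) P Q))) :
    ENNReal.ofReal (b - a) ≤ volume (graphDomain ⊥ ⊤ F) +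
      curveModulus (connectingCurves φ (graphDomain ⊥ ⊤ F) P Q) := by
  have h1 : ∫⁻ x in Ioo a b, (F x)⁻¹ ≤
      curveModulus (connectingCurves φ (graphDomain ⊥ ⊤ F) P Q) := by
    have := lintegral_inv_le_curveModulus (F := F) (p := a) (q := b) one_pos
      (Γ := connectingCurves φ (graphDomain ⊥ ⊤ F) P Q) fun x hx => by
        obtain ⟨hP, hQ⟩ := (mem_xCoordinates_iff hφ hPQ).1 (hab hx)
        exact (vertical_mem_verticalSegments hφ hPQ hP hQ).1
    rwa [ENNReal.ofReal_one, one_mul] at this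
  calc ENNReal.ofReal (b - a) = ∫⁻ _ in Ioo a b, 1 := by rw [setLIntegral_one, Real.volume_Ioo]
    _ ≤ ∫⁻ x in Ioo a b, (F x + (F x)⁻¹) := by
      refine lintegral_mono fun x => ?_
      rcases le_total 1 (F x) with h | h
      · exact h.trans le_self_add
      · exact (ENNReal.one_le_inv.2 h).trans le_add_self
    _ = (∫⁻ x in Ioo a b, F x) + ∫⁻ x in Ioo a b, (F x)⁻¹ := lintegral_add_left hF _
    _ ≤ _ := by
      rw [volume_graphDomain hF]
      gcongr
      exact Measure.restrict_le_self

/-- The limit positions form an interval, whose interior points are positions of vertical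
segments. -/
theorem exists_interval (hF : Measurable F) (harea : volume (graphDomain ⊥ ⊤ F) < ∞) :
    ∃ p q : ℝ, p ≤ q ∧
      Ioo p q ⊆ xCoordinates (verticalSegments (connectingCurves φ (graphDomain ⊥ ⊤ F) P Q)) ∧
      limitPositions (connectingCurves φ (graphDomain ⊥ ⊤ F) P Q) ⊆ Icc p q := by
  set Z := limitPositions (connectingCurves φ (graphDomain ⊥ ⊤ F) P Q)
  rcases Z.eq_empty_or_nonempty with hZ | ⟨x₀, hx₀⟩
  · exact ⟨0, 0, le_rfl, by simp, by simp [hZ]⟩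
  set C := volume (graphDomain ⊥ ⊤ F) +
    curveModulus (connectingCurves φ (graphDomain ⊥ ⊤ F) P Q)
  have hC : C ≠ ∞ := (ENNReal.add_lt_top.2 ⟨harea, curveModulus_connectingCurves_lt_top hφ hPQ⟩).ne
  have hdist : ∀ s ∈ Z, ∀ t ∈ Z, t - s ≤ C.toReal := by
    intro s hs t ht
    have := ofReal_sub_le_of_Ioo_subset hφ hPQ hF (a := s) (b := t) fun x hx =>
      mem_xCoordinates_of_between hφ hPQ hs ht hx.1 hx.2
    exact (ENNReal.ofReal_le_iff_le_toReal hC).1 this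
  have hbelow : BddBelow Z := ⟨x₀ - C.toReal, fun s hs => by linarith [hdist s hs x₀ hx₀]⟩
  have habove : BddAbove Z := ⟨x₀ + C.toReal, fun s hs => by linarith [hdist x₀ hx₀ s hs]⟩
  refine ⟨sInf Z, sSup Z, (csInf_le hbelow hx₀).trans (le_csSup habove hx₀), ?_,
    fun x hx => ⟨csInf_le hbelow hx, le_csSup habove hx⟩⟩
  rintro x ⟨h1, h2⟩
  obtain ⟨s, hs, hsx⟩ := exists_lt_of_csInf_lt ⟨x₀, hx₀⟩ h1
  obtain ⟨t, ht, hxt⟩ := exists_lt_of_lt_csSup ⟨x₀, hx₀⟩ h2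
  exact mem_xCoordinates_of_between hφ hPQ hs ht hsx hxt

end Interval

/-! ### Lipschitz minorants and the crossing metric. -/

/-- A positive lower semicontinuous function on a compact interval has positive Lipschitz minorants
whose inverses have almost the same integral. -/
theorem exists_lipschitz_minorant {F : ℝ → ℝ≥0∞} (hF : LowerSemicontinuous F) {a b : ℝ}
    (hab : a ≤ b) (hpos : ∀ x ∈ Icc a b, 0 < F x) (hfin : ∫⁻ x in Icc a b, (F x)⁻¹ ≠ ∞)
    {η : ℝ≥0∞} (hη : η ≠ 0) :
    ∃ (K : NNReal) (g : ℝ → ℝ), LipschitzWith K g ∧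
      (∀ x ∈ Icc a b, 0 < g x ∧ ENNReal.ofReal (g x) ≤ F x) ∧
      ∫⁻ x in Icc a b, (ENNReal.ofReal (g x))⁻¹ ≤ (∫⁻ x in Icc a b, (F x)⁻¹) + η := by
  obtain ⟨y, hy, hmin⟩ := (hF.lowerSemicontinuousOn (Icc a b)).exists_isMinOn
    (nonempty_Icc.2 hab) isCompact_Icc
  obtain ⟨κ, -, hκ⟩ := ENNReal.lt_iff_exists_real_btwn.1 (hpos y hy)
  have hκ0 : 0 < κ := ENNReal.ofReal_pos.1 hκ.1
  have hκF : ∀ t ∈ Icc a b, ENNReal.ofReal κ < F t := fun t ht => hκ.2.trans_le (hmin ht)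
  have hne : Nonempty (Icc a b) := ⟨⟨a, left_mem_Icc.2 hab⟩⟩
  -- Inf-convolution with slope `n + 1`; truncating `F` at `n + 1` makes it real-valued.
  set c : ℕ → ℝ → Icc a b → ℝ := fun n x t =>
    (min (F t) (n + 1 : ℕ)).toReal + (n + 1 : ℕ) * |x - t| with hc
  have hc0 : ∀ n x t, 0 ≤ c n x t := fun n x t => by positivity
  have hbdd : ∀ n x, BddBelow (range (c n x)) := fun n x => ⟨0, by rintro _ ⟨t, rfl⟩; exact hc0 n x t⟩
  set g : ℕ → ℝ → ℝ := fun n x => ⨅ t, c n x t with hg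
  have htop : ∀ n t, min (F t) (n + 1 : ℕ) ≠ ∞ := fun n t =>
    ((min_le_right _ _).trans_lt (ENNReal.natCast_lt_top _)).ne
  have hlip : ∀ n, LipschitzWith (n + 1 : ℕ) (g n) := by
    intro n
    refine LipschitzWith.of_le_add_mul _ fun x y => ?_
    rw [← sub_le_iff_le_add]
    refine le_ciInf fun t => ?_
    rw [sub_le_iff_le_add]
    refine (ciInf_le (hbdd n x) t).trans ?_
    have h1 : |x - t| ≤ |y - t| + |x - y| := by
      have := abs_sub_le x y t
      linarith
    have h2 := mul_le_mul_of_nonneg_left h1 (Nat.cast_nonneg (α := ℝ) (n + 1))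
    rw [Real.dist_eq]
    simp only [hc, NNReal.coe_natCast]
    linarith
  have hle : ∀ n, ∀ x ∈ Icc a b, ENNReal.ofReal (g n x) ≤ F x := by
    intro n x hx
    have h1 : g n x ≤ (min (F x) (n + 1 : ℕ)).toReal := by
      refine (ciInf_le (hbdd n x) ⟨x, hx⟩).trans ?_
      simp [hc]
    refine (ENNReal.ofReal_le_ofReal h1).trans ?_
    rw [ENNReal.ofReal_toReal (htop n x)]
    exact min_le_left _ _
  -- A lower bound uniform in `n`, which supplies the dominating function for the inverses.
  have hlow : ∀ n x, min κ 1 ≤ g n x := by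
    intro n x
    refine le_ciInf fun t => le_add_of_le_of_nonneg ?_ (by positivity)
    rw [← ENNReal.ofReal_le_iff_le_toReal (htop n t)]
    refine le_min ((ENNReal.ofReal_le_ofReal (min_le_left _ _)).trans (hκF t t.2).le) ?_
    refine (ENNReal.ofReal_le_ofReal (min_le_right _ _)).trans ?_
    rw [ENNReal.ofReal_one]
    exact_mod_cast Nat.succ_le_succ n.zero_le
  have hg0 : ∀ n x, 0 < g n x := fun n x => (lt_min hκ0 one_pos).trans_le (hlow n x)
  have hlim : ∀ x ∈ Icc a b, Tendsto (fun n => ENNReal.ofReal (g n x)) atTop (𝓝 (F x)) := by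
    intro x hx
    refine tendsto_order.2 ⟨fun m hm => ?_, fun m hm => ?_⟩
    · obtain ⟨s, hs0, hms, hsF⟩ := ENNReal.lt_iff_exists_real_btwn.1 hm
      obtain ⟨r, hr, hrF⟩ := Metric.eventually_nhds_iff.1 (hF x _ hsF)
      obtain ⟨n₀, hn₀⟩ := exists_nat_ge (max s (s / r))
      filter_upwards [eventually_ge_atTop n₀] with n hn
      refine hms.trans_le (ENNReal.ofReal_le_ofReal (le_ciInf fun t => ?_))
      have hn1 : max s (s / r) ≤ (n + 1 : ℕ) := hn₀.trans (by
        exact_mod_cast hn.trans n.le_succ)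
      have hn2 : s ≤ (n + 1 : ℕ) := (le_max_left _ _).trans hn1
      -- For `t` near `x`, semicontinuity keeps `F t` above `s`; for `t` far away, the slope penalty
      -- alone exceeds `s`.
      rcases lt_or_ge |x - t| r with h | h
      · refine le_add_of_le_of_nonneg ?_ (by positivity)
        rw [← ENNReal.ofReal_le_iff_le_toReal (htop n t)]
        refine le_min (hrF ?_).le ?_
        · rwa [dist_comm, Real.dist_eq]
        · refine (ENNReal.ofReal_le_ofReal hn2).trans ?_
          rw [ENNReal.ofReal_natCast]
      · refine le_add_of_nonneg_of_le ENNReal.toReal_nonneg ?_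
        have h3 : s ≤ (n + 1 : ℕ) * r := (div_le_iff₀ hr).1 ((le_max_right _ _).trans hn1)
        exact h3.trans (mul_le_mul_of_nonneg_left h (by positivity))
    · exact Eventually.of_forall fun n => (hle n x hx).trans_lt hm
  have hint : Tendsto (fun n => ∫⁻ x in Icc a b, (ENNReal.ofReal (g n x))⁻¹) atTop
      (𝓝 (∫⁻ x in Icc a b, (F x)⁻¹)) := by
    refine tendsto_lintegral_of_dominated_convergence (fun _ => (ENNReal.ofReal (min κ 1))⁻¹)
      (fun n => ((hlip n).continuous.measurable.ennreal_ofReal).inv) (fun n => ?_) ?_ ?_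
    · exact Eventually.of_forall fun x =>
        ENNReal.inv_le_inv.2 (ENNReal.ofReal_le_ofReal (hlow n x))
    · rw [setLIntegral_const, Real.volume_Icc]
      refine ENNReal.mul_ne_top (ENNReal.inv_ne_top.2 ?_) ENNReal.ofReal_ne_top
      exact (ENNReal.ofReal_pos.2 (lt_min hκ0 one_pos)).ne'
    · refine (ae_restrict_iff' measurableSet_Icc).2 (Eventually.of_forall fun x hx => ?_)
      exact (tendsto_inv_iff).2 (hlim x hx)
  obtain ⟨n, hn⟩ := (hint.eventually (ge_mem_nhds (ENNReal.lt_add_right hfin hη))).exists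
  exact ⟨_, g n, hlip n, fun x hx => ⟨hg0 n x, hle n x hx⟩, hn⟩

theorem lintegral_comp_verticalScaling_inv {ε : ℝ} (hε : 0 < ε) {h : ℂ → ℝ≥0∞}
    (hh : Measurable h) :
    ∫⁻ z, h (verticalScaling ε⁻¹ z) = ENNReal.ofReal ε * ∫⁻ z, h z := by
  rw [lintegral_complex_eq_lintegral_lintegral (h := fun z => h (verticalScaling ε⁻¹ z))
      (hh.comp (verticalScaling ε⁻¹).measurable), lintegral_complex_eq_lintegral_lintegral hh,
        ← lintegral_const_mul]
  · refine lintegral_congr fun x => ?_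
    simp only [verticalScaling_apply]
    have hm : Measurable fun y : ℝ => h ⟨x, y⟩ :=
      hh.comp (Complex.measurableEquivRealProd.symm.measurable.comp measurable_prodMk_left)
    have h1 := Real.map_volume_mul_left (inv_pos.2 hε).ne'
    rw [← lintegral_map (f := fun y : ℝ => h ⟨x, y⟩) (g := fun y => ε⁻¹ * y) hm
      (measurable_const_mul _), h1, lintegral_smul_measure, inv_inv, abs_of_pos hε]
    rfl
  · exact (hh.comp Complex.measurableEquivRealProd.symm.measurable).lintegral_prod_right'

/-- The metric is written in unscaled coordinates and divided by `ε`, so that the factor `ε⁻²`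
cancels the Jacobian and the prefactor `ε`. -/
theorem ofReal_mul_curveModulus_le {Γ : Set PlaneCurve} {ε : ℝ} (hε : 0 < ε) {r : ℂ → ℝ≥0∞}
    (hr : Measurable r) (h : ∀ γ ∈ Γ, 1 ≤ (PlaneCurve.map (verticalScaling ε) γ).lineIntegral
      fun z => r (verticalScaling ε⁻¹ z) / ENNReal.ofReal ε) :
    ENNReal.ofReal ε * curveModulus (PlaneCurve.map (verticalScaling ε) '' Γ) ≤ ∫⁻ z, r z ^ 2 := by
  have hε0 : ENNReal.ofReal ε ≠ 0 := (ENNReal.ofReal_pos.2 hε).ne'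
  have hεt : ENNReal.ofReal ε ≠ ∞ := ENNReal.ofReal_ne_top
  have hadm : IsAdmissible (PlaneCurve.map (verticalScaling ε) '' Γ)
      fun z => r (verticalScaling ε⁻¹ z) / ENNReal.ofReal ε := by
    refine ⟨(hr.comp (verticalScaling ε⁻¹).measurable).div_const _, ?_⟩
    rintro _ ⟨γ, hγ, rfl⟩
    exact h γ hγ
  calc ENNReal.ofReal ε * curveModulus (PlaneCurve.map (verticalScaling ε) '' Γ)
      ≤ ENNReal.ofReal ε * ∫⁻ z, (r (verticalScaling ε⁻¹ z) / ENNReal.ofReal ε) ^ 2 := by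
        gcongr
        exact curveModulus_le hadm
    _ = ENNReal.ofReal ε * ∫⁻ z, (fun z => (r z / ENNReal.ofReal ε) ^ 2)
          (verticalScaling ε⁻¹ z) := rfl
    _ = ENNReal.ofReal ε * (ENNReal.ofReal ε * ∫⁻ z, (r z / ENNReal.ofReal ε) ^ 2) := by
        rw [lintegral_comp_verticalScaling_inv hε ((hr.div_const _).pow_const 2)]
    _ = ENNReal.ofReal ε * (ENNReal.ofReal ε * ∫⁻ z, r z ^ 2 * (ENNReal.ofReal ε)⁻¹ ^ 2) := by
        simp only [div_eq_mul_inv, mul_pow]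
    _ = (ENNReal.ofReal ε * (ENNReal.ofReal ε)⁻¹) ^ 2 * ∫⁻ z, r z ^ 2 := by
        rw [lintegral_mul_const _ (hr.pow_const 2)]
        ring
    _ = ∫⁻ z, r z ^ 2 := by rw [ENNReal.mul_inv_cancel hε0 hεt, one_pow, one_mul]

/-- The function `(x, y) ↦ min 1 (y / (ε g(x)))` is Lipschitz with constant about
`(1 + ε K) / (ε g)` below the graph of `ε g`. -/
theorem strictLipschitzAt_min_div {K : NNReal} {g : ℝ → ℝ} (hg : LipschitzWith K g) {ε : ℝ}
    (hε : 0 < ε) {w₀ : ℂ} (hg0 : 0 < g w₀.re) (him : 0 ≤ w₀.im) (hle : w₀.im ≤ ε * g w₀.re) :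
    StrictLipschitzAt (fun w => min 1 (w.im / (ε * g w.re))) ((1 + ε * K) / (ε * g w₀.re)) w₀ := by
  refine ⟨by positivity, fun η hη => ?_⟩
  have hgc := hg.continuous
  have hΦ : ContinuousAt (fun u : ℂ × ℂ => 1 / (ε * g u.1.re) +
      |u.2.im| * K / (ε * g u.1.re * g u.2.re)) (w₀, w₀) := by
    have h1 : ε * g w₀.re ≠ 0 := by positivity
    have h2 : ε * g w₀.re * g w₀.re ≠ 0 := by positivity
    have e1 : Continuous fun u : ℂ × ℂ => g u.1.re :=
      hgc.comp (Complex.continuous_re.comp continuous_fst)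
    have e2 : Continuous fun u : ℂ × ℂ => g u.2.re :=
      hgc.comp (Complex.continuous_re.comp continuous_snd)
    have e3 : Continuous fun u : ℂ × ℂ => u.2.im := Complex.continuous_im.comp continuous_snd
    refine ContinuousAt.add (ContinuousAt.div continuousAt_const ?_ h1)
      (ContinuousAt.div ?_ ?_ h2) <;> exact Continuous.continuousAt (by fun_prop)
  -- The first term is the vertical derivative and the second bounds the horizontal one; `w₀.im ≤ ε
  -- g` reduces the latter to `εK / (εg)`. By continuity the bound persists for pairs of points near
  -- `w₀`.
  have hval : 1 / (ε * g w₀.re) + |w₀.im| * K / (ε * g w₀.re * g w₀.re) <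
      (1 + ε * K) / (ε * g w₀.re) + η := by
    have h1 : |w₀.im| * K / (ε * g w₀.re * g w₀.re) ≤ ε * K / (ε * g w₀.re) := by
      rw [abs_of_nonneg him, div_le_div_iff₀ (by positivity) (by positivity)]
      have h2 := mul_le_mul_of_nonneg_right hle (by positivity : 0 ≤ K * (ε * g w₀.re))
      calc w₀.im * K * (ε * g w₀.re) = w₀.im * (K * (ε * g w₀.re)) := by ring
        _ ≤ _ := h2
        _ = _ := by ring
    rw [add_div]
    linarith
  have hev := hΦ.eventually (gt_mem_nhds hval)
  rw [nhds_prod_eq] at hev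
  obtain ⟨N, hN, hsub⟩ := mem_prod_same_iff.1 hev
  have hbound : ∀ w ∈ N, ∀ w' ∈ N, 1 / (ε * g w.re) + |w'.im| * K / (ε * g w.re * g w'.re) <
      (1 + ε * K) / (ε * g w₀.re) + η := fun w hw w' hw' => hsub (mk_mem_prod hw hw')
  have hgpos : ∀ᶠ w : ℂ in 𝓝 w₀, 0 < g w.re :=
    (hgc.comp Complex.continuous_re).continuousAt.eventually (lt_mem_nhds hg0)
  refine ⟨N ∩ {w | 0 < g w.re}, inter_mem hN hgpos, ?_⟩
  rintro w ⟨hw, hgw⟩ w' ⟨hw', hgw'⟩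
  rw [mem_ofPred_eq] at hgw hgw'
  have hdist : dist (min 1 (w.im / (ε * g w.re))) (min 1 (w'.im / (ε * g w'.re))) ≤
      |w.im / (ε * g w.re) - w'.im / (ε * g w'.re)| := by
    rw [Real.dist_eq]
    refine (abs_min_sub_min_le_max _ _ _ _).trans ?_
    simp
  refine hdist.trans (le_trans ?_ (mul_le_mul_of_nonneg_right (hbound w hw w' hw').le dist_nonneg))
  have hid : w.im / (ε * g w.re) - w'.im / (ε * g w'.re) =
      (w.im - w'.im) / (ε * g w.re) + w'.im * (g w'.re - g w.re) / (ε * g w.re * g w'.re) := by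
    field_simp
    ring
  have h1 : |w.im - w'.im| ≤ dist w w' := by
    rw [dist_eq_norm, ← Complex.sub_im]; exact Complex.abs_im_le_norm _
  have h2 : |g w'.re - g w.re| ≤ K * dist w w' := by
    have h3 := hg.dist_le_mul w'.re w.re
    have h4 : |w'.re - w.re| ≤ dist w w' := by
      rw [dist_comm, dist_eq_norm, ← Complex.sub_re]; exact Complex.abs_re_le_norm _
    rw [Real.dist_eq, Real.dist_eq] at h3
    exact h3.trans (mul_le_mul_of_nonneg_left h4 K.2)
  rw [hid]
  refine (abs_add_le _ _).trans ?_
  rw [abs_div, abs_div, abs_mul w'.im, abs_of_pos (by positivity : 0 < ε * g w.re),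
    abs_of_pos (by positivity : 0 < ε * g w.re * g w'.re), add_mul]
  gcongr ?_ + ?_
  · rw [div_mul_eq_mul_div, one_mul]
    gcongr
  · rw [div_mul_eq_mul_div, mul_assoc |w'.im|]
    gcongr

/-- A curve passing from the bottom to the graph of `g` has length at least `1`, after vertical
scaling, for a metric dominating the gradient of `(x, y) ↦ y / (ε g(x))`. -/
theorem one_le_lineIntegral_of_crosses_graphs {γ : PlaneCurve} {K : NNReal} {g : ℝ → ℝ}
    (hg : LipschitzWith K g) {ε : ℝ} (hε : 0 < ε) (hg0 : ∀ z ∈ γ.trace, 0 < g z.re)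
    (him : ∀ z ∈ γ.trace, 0 < z.im)
    (hlow : ∀ t ∈ Ioo (0 : ℝ) 1, ∃ z ∈ γ.trace, z.im ≤ t * g z.re)
    (hhigh : ∀ t ∈ Ioo (0 : ℝ) 1, ∃ z ∈ γ.trace, t * g z.re ≤ z.im) {ρ : ℂ → ℝ≥0∞}
    (hρ : ∀ z ∈ γ.trace, z.im ≤ g z.re →
      ENNReal.ofReal ((1 + ε * K) / (ε * g z.re)) ≤ ρ (verticalScaling ε z)) :
    1 ≤ (PlaneCurve.map (verticalScaling ε) γ).lineIntegral ρ := by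
  set G : ℂ → ℝ := fun w => min 1 (w.im / (ε * g w.re)) with hG
  have hGz : ∀ z, 0 < g z.re → G (verticalScaling ε z) = min 1 (z.im / g z.re) := by
    intro z hz
    simp only [hG, verticalScaling_apply]
    rw [mul_div_mul_left _ _ hε.ne']
  have hlip : ∀ z ∈ (PlaneCurve.map (verticalScaling ε) γ).trace,
      ∃ c, ENNReal.ofReal c ≤ ρ z ∧ StrictLipschitzAt G c z := by
    rintro _ ⟨t, ht, rfl⟩
    have hz : γ.toFun t ∈ γ.trace := ⟨t, ht, rfl⟩
    change ∃ c, ENNReal.ofReal c ≤ ρ (verticalScaling ε (γ.toFun t)) ∧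
      StrictLipschitzAt G c (verticalScaling ε (γ.toFun t))
    set z := γ.toFun t
    have hgz := hg0 z hz
    have hre : (verticalScaling ε z).re = z.re := by rw [verticalScaling_apply]
    have himz : (verticalScaling ε z).im = ε * z.im := by rw [verticalScaling_apply]
    rcases le_or_gt z.im (g z.re) with h | h
    · refine ⟨_, hρ z hz h, ?_⟩
      have := strictLipschitzAt_min_div hg hε (w₀ := verticalScaling ε z) (by rwa [hre])
        (by rw [himz]; exact (mul_pos hε (him z hz)).le)
        (by rw [himz, hre]; exact mul_le_mul_of_nonneg_left h hε.le)
      rwa [hre] at this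
    -- Above the graph the truncation makes `G` locally constant, so nothing is required of `ρ`
    -- there.
    · refine ⟨0, by simp, le_rfl, fun η hη => ?_⟩
      have hgc := hg.continuous.comp Complex.continuous_re
      have h1 : ∀ᶠ w : ℂ in 𝓝 (verticalScaling ε z), 0 < g w.re :=
        hgc.continuousAt.eventually (lt_mem_nhds (by rwa [Function.comp_apply, hre]))
      have h2 : ∀ᶠ w : ℂ in 𝓝 (verticalScaling ε z), ε * g w.re < w.im :=
        (continuous_const.mul hgc).continuousAt.eventually_lt Complex.continuous_im.continuousAt (by
          change ε * g (verticalScaling ε z).re < (verticalScaling ε z).im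
          rw [hre, himz]
          exact mul_lt_mul_of_pos_left h hε)
      refine ⟨_, h1.and h2, ?_⟩
      have hone : ∀ w : ℂ, 0 < g w.re → ε * g w.re < w.im → G w = 1 := by
        intro w hw1 hw2
        refine min_eq_left ?_
        rw [one_le_div (by positivity)]
        exact hw2.le
      rintro w ⟨hw1, hw2⟩ w' ⟨hw1', hw2'⟩
      rw [hone w hw1 hw2, hone w' hw1' hw2', dist_self]
      positivity
  refine le_of_forall_lt fun a ha => ?_
  obtain ⟨b, hb0, hab, hb⟩ := ENNReal.lt_iff_exists_real_btwn.1 ha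
  have hb1 : b < 1 := ENNReal.ofReal_lt_one.1 hb
  obtain ⟨_, ⟨s, hs, rfl⟩, hz⟩ := hlow ((1 - b) / 2) ⟨by linarith, by linarith⟩
  obtain ⟨_, ⟨t, ht, rfl⟩, hz'⟩ := hhigh ((1 + b) / 2) ⟨by linarith, by linarith⟩
  refine hab.trans_le (le_trans ?_
    ((PlaneCurve.map (verticalScaling ε) γ).edist_le_lineIntegral hlip hs ht))
  rw [edist_comm, edist_dist, Real.dist_eq]
  refine ENNReal.ofReal_le_ofReal (le_trans ?_ (le_abs_self _))
  simp only [PlaneCurve.map]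
  have g1 := hg0 _ ⟨s, hs, rfl⟩
  have g2 := hg0 _ ⟨t, ht, rfl⟩
  rw [hGz _ g1, hGz _ g2]
  have i1 : min 1 ((γ.toFun s).im / g (γ.toFun s).re) ≤ (1 - b) / 2 :=
    (min_le_right _ _).trans ((div_le_iff₀ g1).2 hz)
  have i2 : (1 + b) / 2 ≤ min 1 ((γ.toFun t).im / g (γ.toFun t).re) :=
    le_min (by linarith) ((le_div_iff₀ g2).2 hz')
  linarith

/-! ### The upper bound for the scaled modulus. -/

/-- A neighbourhood of `p`, of `q` and of infinity. -/
def exceptionalZone (p q : ℝ) (n : ℕ) : Set ℝ :=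
  {x | (n : ℝ) < |x|} ∪ ball p (2 / (n + 1)) ∪ ball q (2 / (n + 1))

theorem measurableSet_exceptionalZone (p q : ℝ) (n : ℕ) :
    MeasurableSet (exceptionalZone p q n) :=
  ((measurableSet_lt measurable_const measurable_norm).union measurableSet_ball).union
    measurableSet_ball

theorem exists_setLIntegral_exceptionalZone_le (p q : ℝ) {k : ℝ → ℝ≥0∞} (hk : ∫⁻ x, k x ≠ ∞)
    {η : ℝ≥0∞} (hη : η ≠ 0) : ∃ n, ∫⁻ x in exceptionalZone p q n, k x ≤ η := by
  -- The zones decrease to a subset of `{p, q}`, so continuity from above of this measure makes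
  -- their masses tend to `0`.
  set ν := volume.withDensity k
  have hanti : Antitone (exceptionalZone p q) := by
    intro m n hmn
    have h1 : (m : ℝ) ≤ n := by exact_mod_cast hmn
    have h2 : (2 : ℝ) / (n + 1) ≤ 2 / (m + 1) := by gcongr
    exact union_subset_union (union_subset_union (fun x (hx : (n : ℝ) < |x|) => h1.trans_lt hx)
      (ball_subset_ball h2)) (ball_subset_ball h2)
  have hfin : ν (exceptionalZone p q 0) ≠ ∞ := by
    rw [withDensity_apply _ (measurableSet_exceptionalZone p q 0)]
    exact ((setLIntegral_le_lintegral _ _).trans_lt hk.lt_top).ne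
  have hlim := tendsto_measure_iInter_atTop (μ := ν)
    (fun n => (measurableSet_exceptionalZone p q n).nullMeasurableSet) hanti ⟨0, hfin⟩
  have hsub : ⋂ n, exceptionalZone p q n ⊆ {p, q} := by
    intro x hx
    rw [mem_iInter] at hx
    by_contra hne
    rw [mem_insert_iff, mem_singleton_iff, not_or] at hne
    have h1 : 0 < dist x p := dist_pos.2 hne.1
    have h2 : 0 < dist x q := dist_pos.2 hne.2
    obtain ⟨n, hn⟩ := exists_nat_ge (max |x| (max (2 / dist x p) (2 / dist x q)))
    have hnx := (le_max_left _ _).trans hn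
    have hnp := ((le_max_left _ _).trans (le_max_right _ _)).trans hn
    have hnq := ((le_max_right _ _).trans (le_max_right _ _)).trans hn
    have hn1 : (0 : ℝ) < n + 1 := by positivity
    rw [div_le_iff₀ h1] at hnp
    rw [div_le_iff₀ h2] at hnq
    rcases hx n with (h | h) | h
    · exact absurd hnx (not_le.2 h)
    · rw [mem_ball, lt_div_iff₀ hn1] at h
      linarith
    · rw [mem_ball, lt_div_iff₀ hn1] at h
      linarith
  have hnull : ν (⋂ n, exceptionalZone p q n) = 0 :=
    withDensity_absolutelyContinuous _ _ (measure_mono_null hsub ((toFinite {p, q}).measure_zero _))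
  rw [hnull] at hlim
  obtain ⟨n, hn⟩ := (hlim.eventually (ge_mem_nhds (pos_iff_ne_zero.2 hη))).exists
  refine ⟨n, ?_⟩
  rwa [Function.comp_apply, withDensity_apply _ (measurableSet_exceptionalZone p q n)] at hn

section UpperBound

variable {φ : ℂ → ℂ} {F : ℝ → ℝ≥0∞} {P Q : Set ℂ} {δ : ℝ}
  (hφ : IsRiemannMap φ (graphDomain ⊥ ⊤ F)) (hPQ : SeparatedArcs P Q δ)
include hφ hPQ

/-- In the interior of the interval of vertical segments, the curves of the family cross the graph
of a Lipschitz function with almost the right integral. -/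
theorem exists_minorant_crossed (hF : LowerSemicontinuous F)
    (harea : volume (graphDomain ⊥ ⊤ F) < ∞) {p q : ℝ}
    (hX : Ioo p q ⊆ xCoordinates (verticalSegments (connectingCurves φ (graphDomain ⊥ ⊤ F) P Q)))
    (hI : ∫⁻ x in Ioo p q, (F x)⁻¹ ≠ ∞) {τ : ℝ} (hτ : 0 < τ) {η : ℝ≥0∞} (hη : η ≠ 0) :
    ∃ (S : Set ℝ) (K : NNReal) (g : ℝ → ℝ), MeasurableSet S ∧ LipschitzWith K g ∧
      (∀ x ∈ S, 0 < g x) ∧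
      ∫⁻ x in S, (ENNReal.ofReal (g x))⁻¹ ≤ (∫⁻ x in Ioo p q, (F x)⁻¹) + η ∧
      ∀ γ ∈ connectingCurves φ (graphDomain ⊥ ⊤ F) P Q,
        (∀ z ∈ γ.trace, p + τ < z.re ∧ z.re < q - τ) → (∀ z ∈ γ.trace, z.re ∈ S) ∧
        ∀ t ∈ Ioo (0 : ℝ) 1, (∃ z ∈ γ.trace, z.im ≤ t * g z.re) ∧
          ∃ z ∈ γ.trace, t * g z.re ≤ z.im := by
  rcases le_or_gt q p with hpq | hpq
  · refine ⟨∅, 0, fun _ => 1, MeasurableSet.empty, LipschitzWith.const 1, by simp, by simp, ?_⟩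
    intro γ hγ hz
    obtain ⟨ζ, -, h⟩ := (accumulates_of_mem_connectingCurves hPQ hγ).exists_dist_lt hφ
    obtain ⟨z, ⟨hzγ, -⟩, -⟩ := h 1 one_pos
    linarith [hz z hzγ]
  have hdense := Measure.dense_of_ae (ae_isGoodSlice hφ hF.measurable harea)
  -- Good slices bounding the strip are taken within `τ` of `p` and of `q`; the midpoint guarantees
  -- `x₁ ≤ x₂`.
  obtain ⟨x₁, hg₁, hx₁p, hx₁⟩ := hdense.exists_between
    (show p < min (p + τ) ((p + q) / 2) from lt_min (by linarith) (by linarith))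
  obtain ⟨x₂, hg₂, hx₂, hx₂q⟩ := hdense.exists_between
    (show max (q - τ) ((p + q) / 2) < q from max_lt (by linarith) (by linarith))
  rw [lt_min_iff] at hx₁
  rw [max_lt_iff] at hx₂
  have h12 : x₁ ≤ x₂ := by linarith
  have hsub : Icc x₁ x₂ ⊆ Ioo p q := Icc_subset_Ioo hx₁p hx₂q
  have hP : ∀ x ∈ Ioo p q, Accumulates φ {z | z.re = x} P := fun x hx =>
    ((mem_xCoordinates_iff hφ hPQ).1 (hX hx)).1
  have hQ : ∀ x ∈ Ioo p q, Accumulates φ {z | z.re = x} Q := fun x hx =>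
    ((mem_xCoordinates_iff hφ hPQ).1 (hX hx)).2
  have hpos : ∀ x ∈ Icc x₁ x₂, 0 < F x := fun x hx => pos_of_accumulates hφ (hP x (hsub hx))
  have hmono : ∫⁻ x in Icc x₁ x₂, (F x)⁻¹ ≤ ∫⁻ x in Ioo p q, (F x)⁻¹ := lintegral_mono_set hsub
  obtain ⟨K, g, hgK, hg, hgI⟩ := exists_lipschitz_minorant hF h12 hpos
    (hmono.trans_lt hI.lt_top).ne hη
  refine ⟨Icc x₁ x₂, K, g, measurableSet_Icc, hgK, fun x hx => (hg x hx).1,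
    hgI.trans (by gcongr), fun γ hγ hz => ?_⟩
  have hz' : ∀ z ∈ γ.trace, x₁ < z.re ∧ z.re < x₂ := fun z h => by
    constructor <;> linarith [hz z h]
  refine ⟨fun z h => ⟨(hz' z h).1.le, (hz' z h).2.le⟩, fun t ht => ?_⟩
  -- The graph of `g` may touch that of `F`; the factor `t < 1` brings it inside `D`.
  refine exists_le_and_exists_ge_graph hφ hF hPQ hP hQ ⟨hx₁p, by linarith⟩ ⟨by linarith, hx₂q⟩ hg₁ hg₂
    h12 (g := fun x => t * g x) (continuous_const.mul hgK.continuous)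
    (fun x hx => mul_pos ht.1 (hg x hx).1) (fun x hx => ?_) hz'
    (accumulates_of_mem_connectingCurves hPQ hγ)
    (accumulates_right_of_mem_connectingCurves hPQ hγ)
  have hgx := hg x hx
  exact ((ENNReal.ofReal_lt_ofReal_iff hgx.1).2 (mul_lt_of_lt_one_left hgx.1 ht.2)).trans_le hgx.2

omit hφ hPQ in
/-- Curves of small horizontal extent lie either in the exceptional zone or well inside `(p, q)`. -/
theorem exists_extent_dichotomy {Γ : Set PlaneCurve} (hne : ∀ γ ∈ Γ, γ.trace.Nonempty) {p q : ℝ}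
    (hZ : limitPositions Γ ⊆ Icc p q) (n : ℕ) :
    ∃ d > 0, ∀ γ ∈ Γ, (∀ z ∈ γ.trace, ∀ z' ∈ γ.trace, |z.re - z'.re| < d) →
      (∀ z ∈ γ.trace, z.re ∈ exceptionalZone p q n) ∨
      ∀ z ∈ γ.trace, p + 1 / (2 * (n + 1)) < z.re ∧ z.re < q - 1 / (2 * (n + 1)) := by
  set τ : ℝ := 1 / (n + 1) with hτdef
  have hn1 : (0 : ℝ) < n + 1 := by positivity
  have hτ : 0 < τ := by positivity
  have hτ1 : τ ≤ 1 := by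
    rw [hτdef, div_le_one hn1]
    linarith [Nat.cast_nonneg (α := ℝ) n]
  have hτ2 : 1 / (2 * ((n : ℝ) + 1)) = τ / 2 := by rw [hτdef]; field_simp
  have hτ3 : 2 / ((n : ℝ) + 1) = 2 * τ := by rw [hτdef]; field_simp
  rw [hτ2]
  -- `T` is compact and contains no limit position; a Lebesgue number gives one width `d₀` that
  -- excludes narrow curves at every point of `T`.
  set T : Set ℝ := Icc (-(n + 1 : ℝ)) (n + 1) \ Ioo (p - τ) (q + τ)
  have hT : IsCompact T := isCompact_Icc.diff isOpen_Ioo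
  have hloc : ∀ x ∈ T, ∃ r > 0, ∀ γ ∈ Γ, ∃ z ∈ γ.trace, r ≤ |z.re - x| := by
    intro x hx
    by_contra! hcon
    have : x ∈ limitPositions Γ := fun r hr => hcon r hr
    have hx' := hZ this
    exact hx.2 ⟨by linarith [hx'.1], by linarith [hx'.2]⟩
  obtain ⟨d₀, hd₀, hT'⟩ : ∃ d₀ > 0, ∀ x ∈ T, ∀ γ ∈ Γ, ∃ z ∈ γ.trace, d₀ ≤ |z.re - x| := by
    choose! r hr hrΓ using hloc
    obtain ⟨d₀, hd₀, hleb⟩ := lebesgue_number_lemma_of_metric (c := fun x : T => ball (x : ℝ) (r x)) hT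
      (fun _ => isOpen_ball) (fun x hx => mem_iUnion.2 ⟨⟨x, hx⟩, mem_ball_self (hr x hx)⟩)
    refine ⟨d₀, hd₀, fun x hx γ hγ => ?_⟩
    obtain ⟨⟨y, hy⟩, hball⟩ := hleb x hx
    obtain ⟨z, hz, hzr⟩ := hrΓ y hy γ hγ
    refine ⟨z, hz, ?_⟩
    by_contra! hcon
    have := hball (show z.re ∈ ball x d₀ by rwa [mem_ball, Real.dist_eq])
    rw [mem_ball, Real.dist_eq] at this
    exact absurd hzr (not_le.2 this)
  refine ⟨min d₀ (τ / 2), lt_min hd₀ (half_pos hτ), fun γ hγ hext => ?_⟩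
  obtain ⟨z₀, hz₀⟩ := hne γ hγ
  have hd : ∀ z ∈ γ.trace, |z.re - z₀.re| < d₀ ∧ |z.re - z₀.re| < τ / 2 := fun z hz =>
    lt_min_iff.1 (hext z hz z₀ hz₀)
  rcases lt_or_ge ((n : ℝ) + 1) |z₀.re| with h1 | h1
  · refine Or.inl fun z hz => Or.inl (Or.inl ?_)
    have h2 := (hd z hz).2
    have h3 := abs_sub_abs_le_abs_sub z₀.re z.re
    rw [abs_sub_comm] at h3
    rw [mem_ofPred_eq]
    linarith
  have hnear : ∀ s : ℝ, |z₀.re - s| < τ → ∀ z ∈ γ.trace, z.re ∈ ball s (2 / ((n : ℝ) + 1)) := by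
    intro s hs z hz
    rw [mem_ball, Real.dist_eq, hτ3]
    have := abs_sub_le z.re z₀.re s
    linarith [(hd z hz).2]
  rcases lt_or_ge |z₀.re - p| τ with hp | hp
  · exact Or.inl fun z hz => Or.inl (Or.inr (hnear p hp z hz))
  rcases lt_or_ge |z₀.re - q| τ with hq | hq
  · exact Or.inl fun z hz => Or.inr (hnear q hq z hz)
  by_cases hmid : z₀.re ∈ Ioo (p - τ) (q + τ)
  · have h2 : p + τ ≤ z₀.re := by
      rcases le_abs'.1 hp with h | h
      · linarith [hmid.1]
      · linarith
    have h3 : z₀.re ≤ q - τ := by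
      rcases le_abs'.1 hq with h | h
      · linarith
      · linarith [hmid.2]
    refine Or.inr fun z hz => ?_
    have h4 := abs_lt.1 (hd z hz).2
    constructor <;> linarith
  · obtain ⟨z, hz, hzd⟩ := hT' z₀.re ⟨abs_le.1 h1, hmid⟩ γ hγ
    exact absurd (hd z hz).1 (not_lt.2 hzd)

theorem eventually_mul_curveModulus_le (hF : LowerSemicontinuous F)
    (harea : volume (graphDomain ⊥ ⊤ F) < ∞) {p q : ℝ}
    (hX : Ioo p q ⊆ xCoordinates (verticalSegments (connectingCurves φ (graphDomain ⊥ ⊤ F) P Q)))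
    (hZ : limitPositions (connectingCurves φ (graphDomain ⊥ ⊤ F) P Q) ⊆ Icc p q)
    (hI : ∫⁻ x in Ioo p q, (F x)⁻¹ ≠ ∞) {η : ℝ≥0∞} (hη : η ≠ 0) (hηt : η ≠ ∞) :
    ∀ᶠ ε : ℝ in 𝓝[>] 0, ENNReal.ofReal ε * curveModulus (PlaneCurve.map (verticalScaling ε) ''
      connectingCurves φ (graphDomain ⊥ ⊤ F) P Q) ≤ (∫⁻ x in Ioo p q, (F x)⁻¹) + η := by
  set D := graphDomain ⊥ ⊤ F with hD
  set Γ := connectingCurves φ D P Q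
  set I := ∫⁻ x in Ioo p q, (F x)⁻¹
  have hδ := hPQ.pos
  have hη4 : η / 4 ≠ 0 := (ENNReal.div_pos hη (by simp)).ne'
  have hDm : MeasurableSet D := hφ.isOpen.measurableSet
  set u : ℂ → ℝ≥0∞ := fun z => ENNReal.ofReal δ⁻¹ * ‖deriv (diskInverse φ) z‖ₑ with hu
  have hum : Measurable u := (measurable_deriv _).enorm.const_mul _
  have hufin : ∫⁻ z in D, u z ^ 2 < ∞ := by
    simp only [hu, mul_pow]
    rw [lintegral_const_mul _ ((measurable_deriv _).enorm.pow_const 2)]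
    exact ENNReal.mul_lt_top (by simp) hφ.lintegral_enorm_deriv_diskInverse_sq_lt_top
  rw [setLIntegral_graphDomain hF.measurable (hum.pow_const 2)] at hufin
  -- `n` is fixed before `ε`: the conformal metric over the exceptional zone then has energy at most
  -- `η/4`, whatever `ε` is.
  obtain ⟨n, hn⟩ := exists_setLIntegral_exceptionalZone_le p q hufin.ne hη4
  set B := exceptionalZone p q n
  have hne : ∀ γ ∈ Γ, γ.trace.Nonempty := by
    intro γ hγ
    obtain ⟨ζ, -, h⟩ := (accumulates_of_mem_connectingCurves hPQ hγ).exists_dist_lt hφ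
    obtain ⟨z, hz, -⟩ := h 1 one_pos
    exact ⟨z, hz.1⟩
  obtain ⟨d, hd, hdich⟩ := exists_extent_dichotomy hne hZ n
  obtain ⟨S, K, g, hSm, hgK, hg0, hgI, hcross⟩ := exists_minorant_crossed hφ hPQ hF harea hX hI
    (τ := 1 / (2 * ((n : ℝ) + 1))) (by positivity) hη4
  have hbound : ∀ ε : ℝ, 0 < ε → ε ≤ 1 →
      ENNReal.ofReal ε * curveModulus (PlaneCurve.map (verticalScaling ε) '' Γ) ≤
        ENNReal.ofReal (ε / d) ^ 2 * volume D + η / 4 +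
          ENNReal.ofReal (1 + ε * K) ^ 2 * (I + η / 4) := by
    intro ε hε hε1
    set R := {z : ℂ | z.re ∈ S ∧ 0 < z.im ∧ z.im ≤ g z.re} with hR
    have hRm : MeasurableSet R :=
      (Complex.measurable_re hSm).inter ((measurableSet_lt measurable_const
        Complex.measurable_im).inter (measurableSet_le Complex.measurable_im
          (hgK.continuous.measurable.comp Complex.measurable_re)))
    set r₁ : ℂ → ℝ≥0∞ := D.indicator fun _ => ENNReal.ofReal (ε / d) with hr₁
    set r₂ : ℂ → ℝ≥0∞ := D.indicator (({z : ℂ | z.re ∈ B}).indicator u) with hr₂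
    set r₃ : ℂ → ℝ≥0∞ := R.indicator fun z => ENNReal.ofReal ((1 + ε * K) / g z.re) with hr₃
    have hBm : MeasurableSet {z : ℂ | z.re ∈ B} :=
      Complex.measurable_re (measurableSet_exceptionalZone p q n)
    have hm₁ : Measurable r₁ := measurable_const.indicator hDm
    have hm₂ : Measurable r₂ := (hum.indicator hBm).indicator hDm
    have hm₃' : Measurable fun z : ℂ => ENNReal.ofReal ((1 + ε * K) / g z.re) :=
      ((hgK.continuous.measurable.comp Complex.measurable_re).const_div _).ennreal_ofReal
    have hm₃ : Measurable r₃ := hm₃'.indicator hRm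
    -- `r₁` serves the curves of extent at least `d`, `r₂` the narrow ones in the exceptional zone,
    -- `r₃` the narrow ones well inside `(p, q)`. The square of the maximum is at most the sum of
    -- the squares.
    set r : ℂ → ℝ≥0∞ := fun z => max (max (r₁ z) (r₂ z)) (r₃ z) with hr
    have hrm : Measurable r := (hm₁.max hm₂).max hm₃
    have hadm : ∀ γ ∈ Γ, 1 ≤ (PlaneCurve.map (verticalScaling ε) γ).lineIntegral
        fun z => r (verticalScaling ε⁻¹ z) / ENNReal.ofReal ε := by
      intro γ hγ
      by_cases hext : ∀ z ∈ γ.trace, ∀ z' ∈ γ.trace, |z.re - z'.re| < d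
      · rcases hdich γ hγ hext with hB | hmid
        · refine one_le_lineIntegral_of_pullback hφ hPQ hγ hε hε1 fun z hz => ?_
          rw [verticalScaling_inv_verticalScaling hε.ne']
          have h1 : u z ≤ r z := by
            refine le_trans (le_of_eq ?_) ((le_max_right (r₁ z) (r₂ z)).trans (le_max_left _ _))
            rw [hr₂, indicator_of_mem (hγ.1 hz), indicator_of_mem (by exact hB z hz)]
          refine le_trans (le_of_eq ?_) (ENNReal.div_le_div_right h1 _)
          change _ = ENNReal.ofReal δ⁻¹ * ‖deriv (diskInverse φ) z‖ₑ / ENNReal.ofReal ε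
          rw [← ofReal_norm, ← ENNReal.ofReal_mul (inv_pos.2 hδ).le,
            ← ENNReal.ofReal_div_of_pos hε]
          congr 1
          field_simp
        · obtain ⟨hzS, hzt⟩ := hcross γ hγ hmid
          refine one_le_lineIntegral_of_crosses_graphs hgK hε (fun z hz => hg0 _ (hzS z hz))
            (fun z hz => (mem_graphDomain_bot_top.1 (hγ.1 hz)).1) (fun t ht => (hzt t ht).1)
            (fun t ht => (hzt t ht).2) fun z hz hzg => ?_
          rw [verticalScaling_inv_verticalScaling hε.ne']
          have h1 : ENNReal.ofReal ((1 + ε * K) / g z.re) ≤ r z := by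
            refine le_trans (le_of_eq ?_) (le_max_right _ (r₃ z))
            have hzR : z ∈ R := ⟨hzS z hz, (mem_graphDomain_bot_top.1 (hγ.1 hz)).1, hzg⟩
            rw [hr₃, indicator_of_mem hzR]
          refine le_trans (le_of_eq ?_) (ENNReal.div_le_div_right h1 _)
          rw [← ENNReal.ofReal_div_of_pos hε, div_div, mul_comm (g z.re) ε]
      · push Not at hext
        obtain ⟨_, ⟨s, hs, rfl⟩, _, ⟨t, ht, rfl⟩, hst⟩ := hext
        have key := (PlaneCurve.map (verticalScaling ε) γ).edist_le_lineIntegral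
          (G := fun w => d⁻¹ * w.re)
          (ρ := fun z => r (verticalScaling ε⁻¹ z) / ENNReal.ofReal ε) (by
            rintro _ ⟨a, ha, rfl⟩
            have hz : γ.toFun a ∈ γ.trace := ⟨a, ha, rfl⟩
            refine ⟨d⁻¹, ?_, strictLipschitzAt_const_mul_re (inv_pos.2 hd).le _⟩
            change _ ≤ r (verticalScaling ε⁻¹ (verticalScaling ε (γ.toFun a))) / ENNReal.ofReal ε
            rw [verticalScaling_inv_verticalScaling hε.ne']
            have h1 : ENNReal.ofReal (ε / d) ≤ r (γ.toFun a) := by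
              refine le_trans (le_of_eq ?_)
                ((le_max_left (r₁ (γ.toFun a)) (r₂ (γ.toFun a))).trans (le_max_left _ _))
              rw [hr₁, indicator_of_mem (hγ.1 hz)]
            refine le_trans (le_of_eq ?_) (ENNReal.div_le_div_right h1 _)
            rw [← ENNReal.ofReal_div_of_pos hε]
            congr 1
            field_simp) hs ht
        refine le_trans ?_ key
        rw [edist_dist, Real.dist_eq, ← mul_sub, abs_mul, abs_of_pos (inv_pos.2 hd)]
        simp only [PlaneCurve.map, verticalScaling_apply]
        rw [ENNReal.one_le_ofReal, inv_mul_eq_div, one_le_div hd]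
        exact hst
    refine (ofReal_mul_curveModulus_le hε hrm hadm).trans ?_
    have hsq : ∀ z, r z ^ 2 ≤ r₁ z ^ 2 + r₂ z ^ 2 + r₃ z ^ 2 := by
      intro z
      rcases max_choice (max (r₁ z) (r₂ z)) (r₃ z) with h | h
      · rw [hr]
        simp only
        rw [h]
        rcases max_choice (r₁ z) (r₂ z) with h' | h' <;> rw [h']
        · rw [add_assoc]
          exact le_self_add
        · exact le_add_self.trans le_self_add
      · rw [hr]
        simp only
        rw [h]
        exact le_add_self
    have i₁ : ∫⁻ z, r₁ z ^ 2 = ENNReal.ofReal (ε / d) ^ 2 * volume D := by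
      have : ∀ z, r₁ z ^ 2 = D.indicator (fun _ => ENNReal.ofReal (ε / d) ^ 2) z := by
        intro z
        by_cases hz : z ∈ D <;> simp [hr₁, hz]
      simp only [this]
      rw [lintegral_indicator_const hDm]
    have i₂ : ∫⁻ z, r₂ z ^ 2 ≤ η / 4 := by
      have : ∀ z, r₂ z ^ 2 = D.indicator (({z : ℂ | z.re ∈ B}).indicator fun z => u z ^ 2) z := by
        intro z
        by_cases hz : z ∈ D <;> by_cases hz' : z.re ∈ B <;> simp [hr₂, hz, hz']
      simp only [this]
      rw [lintegral_indicator hDm, hD,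
        setLIntegral_graphDomain hF.measurable ((hum.pow_const 2).indicator hBm)]
      refine le_trans (le_of_eq ?_) hn
      rw [← lintegral_indicator (measurableSet_exceptionalZone p q n)]
      refine lintegral_congr fun x => ?_
      by_cases hx : x ∈ B
      · rw [indicator_of_mem hx]
        refine lintegral_congr fun y => ?_
        rw [indicator_of_mem (by exact hx)]
      · rw [indicator_of_notMem hx]
        rw [← lintegral_zero (μ := volume.restrict (heightSet (F x)))]
        refine lintegral_congr fun y => ?_
        rw [indicator_of_notMem (by exact hx)]
    have i₃ : ∫⁻ z, r₃ z ^ 2 ≤ ENNReal.ofReal (1 + ε * K) ^ 2 * (I + η / 4) := by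
      rw [lintegral_complex_eq_lintegral_lintegral (hm₃.pow_const 2)]
      refine le_trans ?_ (mul_le_mul_right hgI _)
      rw [← lintegral_const_mul (f := fun x => (ENNReal.ofReal (g x))⁻¹) _
          hgK.continuous.measurable.ennreal_ofReal.inv,
        ← lintegral_indicator hSm]
      refine lintegral_mono fun x => ?_
      by_cases hx : x ∈ S
      · have hgx := hg0 x hx
        have hval : ∀ y : ℝ, r₃ ⟨x, y⟩ ^ 2 =
            (Ioc 0 (g x)).indicator (fun _ => ENNReal.ofReal ((1 + ε * K) / g x) ^ 2) y := by
          intro y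
          by_cases hy : y ∈ Ioc 0 (g x)
          · have : (⟨x, y⟩ : ℂ) ∈ R := ⟨hx, hy.1, hy.2⟩
            rw [indicator_of_mem hy, hr₃, indicator_of_mem this]
          · have : (⟨x, y⟩ : ℂ) ∉ R := fun h => hy ⟨h.2.1, h.2.2⟩
            rw [indicator_of_notMem hy, hr₃, indicator_of_notMem this]
            simp
        simp only [hval]
        rw [lintegral_indicator_const measurableSet_Ioc, Real.volume_Ioc, sub_zero,
          indicator_of_mem hx, ENNReal.ofReal_div_of_pos hgx, div_eq_mul_inv, mul_pow, mul_assoc]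
        have h0 := (ENNReal.ofReal_pos.2 hgx).ne'
        gcongr
        rw [sq, mul_assoc, ENNReal.inv_mul_cancel h0 ENNReal.ofReal_ne_top, mul_one]
      · have hval : ∀ y : ℝ, r₃ ⟨x, y⟩ ^ 2 = 0 := by
          intro y
          have : (⟨x, y⟩ : ℂ) ∉ R := fun h => hx h.1
          rw [hr₃, indicator_of_notMem this]
          simp
        simp [hval]
    calc ∫⁻ z, r z ^ 2 ≤ ∫⁻ z, (r₁ z ^ 2 + r₂ z ^ 2 + r₃ z ^ 2) := lintegral_mono hsq
      _ = (∫⁻ z, r₁ z ^ 2) + (∫⁻ z, r₂ z ^ 2) + ∫⁻ z, r₃ z ^ 2 := by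
        rw [lintegral_add_left (f := fun z => r₁ z ^ 2 + r₂ z ^ 2)
            ((hm₁.pow_const 2).add (hm₂.pow_const 2)),
          lintegral_add_left (hm₁.pow_const 2)]
      _ ≤ _ := by
        rw [i₁]
        gcongr
  have hlim : Tendsto (fun ε : ℝ => ENNReal.ofReal (ε / d) ^ 2 * volume D + η / 4 +
      ENNReal.ofReal (1 + ε * K) ^ 2 * (I + η / 4)) (𝓝[>] 0)
      (𝓝 (ENNReal.ofReal (0 / d) ^ 2 * volume D + η / 4 +
        ENNReal.ofReal (1 + 0 * K) ^ 2 * (I + η / 4))) := by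
    have hIη : I + η / 4 ≠ ∞ := ENNReal.add_ne_top.2 ⟨hI, (ENNReal.div_lt_top hηt (by simp)).ne⟩
    have c1 : Continuous fun ε : ℝ => ENNReal.ofReal (ε / d) :=
      ENNReal.continuous_ofReal.comp (by fun_prop)
    have c2 : Continuous fun ε : ℝ => ENNReal.ofReal (1 + ε * K) :=
      ENNReal.continuous_ofReal.comp (by fun_prop)
    refine Tendsto.mono_left ?_ nhdsWithin_le_nhds
    refine Tendsto.add (Tendsto.add (ENNReal.Tendsto.mul_const ?_ (Or.inr harea.ne))
      tendsto_const_nhds) (ENNReal.Tendsto.mul_const ?_ (Or.inr hIη))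
    · exact ((ENNReal.continuous_pow 2).comp c1).tendsto 0
    · exact ((ENNReal.continuous_pow 2).comp c2).tendsto 0
  -- In the limit the wide curves cost nothing, and `I + η/2` remains.
  have hlt : ENNReal.ofReal (0 / d) ^ 2 * volume D + η / 4 +
        ENNReal.ofReal (1 + 0 * K) ^ 2 * (I + η / 4) < I + η := by
    have hhalf : η / 4 + η / 4 = η / 2 := by
      rw [← ENNReal.add_halves (η / 2)]
      have : η / 2 / 2 = η / 4 := by
        rw [div_eq_mul_inv, div_eq_mul_inv, div_eq_mul_inv, mul_assoc,
          ← ENNReal.mul_inv (by simp) (by simp)]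
        norm_num
      rw [this]
    simp only [zero_div, ENNReal.ofReal_zero, zero_mul, add_zero, ENNReal.ofReal_one, one_pow,
      one_mul, ne_eq, OfNat.ofNat_ne_zero, not_false_eq_true, zero_pow, zero_add]
    rw [add_left_comm, hhalf]
    exact ENNReal.add_lt_add_left hI (ENNReal.half_lt_self hη hηt)
  filter_upwards [hlim.eventually (gt_mem_nhds hlt), self_mem_nhdsWithin,
    mem_nhdsWithin_of_mem_nhds (Iic_mem_nhds (zero_lt_one' ℝ))] with ε h1 h2 h3
  exact (hbound ε h2 h3).trans h1.le

end UpperBound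

/-! ### Separation of the arcs, extension by zero, and the conclusion. -/

theorem openArc_separated {a b c d : ℝ} (hab : a < b) (hbc : b < c) (hcd : c < d)
    (hda : d < a + 2 * Real.pi) : ∃ δ, SeparatedArcs (openArc a b) (openArc c d) δ := by
  have hcont : Continuous fun θ : ℝ => Complex.exp (θ * Complex.I) := by fun_prop
  have hconn : ∀ s t : ℝ, s < t → IsConnected (openArc s t) := fun s t hst =>
    (isConnected_Ioo hst).image _ hcont.continuousOn
  have hsub : ∀ s t : ℝ, openArc s t ⊆ sphere 0 1 := by
    rintro s t _ ⟨θ, -, rfl⟩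
    rw [mem_sphere_zero_iff_norm]
    exact Complex.norm_exp_ofReal_mul_I θ
  have hcpt : ∀ s t : ℝ, IsCompact ((fun θ : ℝ => Complex.exp (θ * Complex.I)) '' Icc s t) :=
    fun s t => isCompact_Icc.image hcont
  -- Angles in `[c, d]` and `[a, b]` differ by an amount strictly between `0` and `2π`. The closed
  -- arcs are thus disjoint compact sets, at positive distance.
  have hdisj : Disjoint ((fun θ : ℝ => Complex.exp (θ * Complex.I)) '' Icc a b)
      ((fun θ : ℝ => Complex.exp (θ * Complex.I)) '' Icc c d) := by
    rw [disjoint_left]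
    rintro _ ⟨θ, hθ, rfl⟩ ⟨θ', hθ', h⟩
    obtain ⟨n, hn⟩ := Complex.exp_eq_exp_iff_exists_int.1 h
    have him := congrArg Complex.im hn
    simp at him
    have hpi := Real.pi_pos
    have h1 : 0 < n := by
      by_contra! hn0
      have : (n : ℝ) ≤ 0 := by exact_mod_cast hn0
      nlinarith [hθ.1, hθ.2, hθ'.1, hθ'.2]
    have h2 : (1 : ℝ) ≤ n := by exact_mod_cast h1
    nlinarith [hθ.1, hθ.2, hθ'.1, hθ'.2]
  obtain ⟨δ, hδ, hdist⟩ := Metric.exists_pos_forall_lt_edist (hcpt a b) (hcpt c d).isClosed hdisj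
  refine ⟨δ, hδ, hconn a b hab, hconn c d hcd, hsub a b, hsub c d, fun ζ hζ ζ' hζ' => ?_⟩
  have := hdist ζ (image_mono Ioo_subset_Icc_self hζ) ζ' (image_mono Ioo_subset_Icc_self hζ')
  rw [edist_nndist, ENNReal.coe_lt_coe] at this
  exact_mod_cast this.le

theorem isOpen_setOf_coe_between (A B : EReal) :
    IsOpen {x : ℝ | A < (x : EReal) ∧ (x : EReal) < B} :=
  (isOpen_lt continuous_const continuous_coe_real_ereal).inter
    (isOpen_lt continuous_coe_real_ereal continuous_const)

theorem LowerSemicontinuousOn.indicator_of_isOpen {f : ℝ → ℝ≥0∞} {U : Set ℝ}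
    (hf : LowerSemicontinuousOn f U) (hU : IsOpen U) : LowerSemicontinuous (U.indicator f) := by
  intro x y hy
  by_cases hx : x ∈ U
  · rw [indicator_of_mem hx] at hy
    have := hf x hx y hy
    rw [hU.nhdsWithin_eq hx] at this
    filter_upwards [this, hU.mem_nhds hx] with z hz hzU
    rwa [indicator_of_mem hzU]
  · rw [indicator_of_notMem hx] at hy
    exact absurd hy not_lt_zero

/-- A slice of height `0` is empty, so extending `f` by zero leaves `D` unchanged and reduces
everything to functions on the whole line. -/
theorem graphDomain_eq_indicator (A B : EReal) (f : ℝ → ℝ≥0∞) :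
    graphDomain A B f =
      graphDomain ⊥ ⊤ ({x : ℝ | A < (x : EReal) ∧ (x : EReal) < B}.indicator f) := by
  ext z
  rw [mem_graphDomain_bot_top]
  by_cases hz : z.re ∈ {x : ℝ | A < (x : EReal) ∧ (x : EReal) < B}
  · rw [indicator_of_mem hz]
    exact ⟨fun h => h.2.2, fun h => ⟨hz.1, hz.2, h⟩⟩
  · rw [indicator_of_notMem hz]
    exact ⟨fun h => absurd ⟨h.1, h.2.1⟩ hz, fun h => absurd h.2 not_lt_zero⟩

theorem theorem1p1 (A B : EReal) (f : ℝ → ℝ≥0∞)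
    (hf : LowerSemicontinuousOn f {x : ℝ | A < (x : EReal) ∧ (x : EReal) < B})
    (hD : SimplyConnectedSpace (graphDomain A B f))
    (harea : volume (graphDomain A B f) < ∞)
    (φ : ℂ → ℂ) (hφ : IsRiemannMap φ (graphDomain A B f))
    (a b c d : ℝ) (hab : a < b) (hbc : b < c) (hcd : c < d) (hda : d < a + 2 * Real.pi)
    (Γ : Set PlaneCurve)
    (hΓ : Γ = connectingCurves φ (graphDomain A B f) (openArc a b) (openArc c d)) :
    ∃ p q : ℝ, p ≤ q ∧
      Ioo p q ⊆ xCoordinates (verticalSegments Γ) ∧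
      xCoordinates (verticalSegments Γ) ⊆ Icc p q ∧
      curveModulus (verticalSegments Γ) = ∫⁻ x in Ioo p q, (f x)⁻¹ ∧
      curveModulus (verticalSegments Γ) < ∞ ∧
      Tendsto (fun ε : ℝ =>
          ENNReal.ofReal ε * curveModulus (PlaneCurve.map (verticalScaling ε) '' Γ))
        (𝓝[>] 0) (𝓝 (curveModulus (verticalSegments Γ))) := by
  obtain ⟨δ, hPQ⟩ := openArc_separated hab hbc hcd hda
  set U := {x : ℝ | A < (x : EReal) ∧ (x : EReal) < B}
  set F := U.indicator f with hFdef
  have hF : LowerSemicontinuous F := hf.indicator_of_isOpen (isOpen_setOf_coe_between A B)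
  rw [graphDomain_eq_indicator A B f] at harea hφ hΓ
  subst hΓ
  set Γ := connectingCurves φ (graphDomain ⊥ ⊤ F) (openArc a b) (openArc c d)
  obtain ⟨p, q, hpq, hX, hZ⟩ := exists_interval hφ hPQ hF.measurable harea
  have hXZ : xCoordinates (verticalSegments Γ) ⊆ Icc p q :=
    (xCoordinates_verticalSegments_subset_limitPositions Γ).trans hZ
  have hvert : ∀ x ∈ Ioo p q, PlaneCurve.vertical x 1 (F x) ∈ verticalSegments Γ := by
    intro x hx
    obtain ⟨hP, hQ⟩ := (mem_xCoordinates_iff hφ hPQ).1 (hX hx)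
    exact vertical_mem_verticalSegments hφ hPQ hP hQ
  -- Slices over `(p, q)` are nonempty, so `(p, q)` lies in the set where `F` agrees with `f`.
  have hfF : ∫⁻ x in Ioo p q, (f x)⁻¹ = ∫⁻ x in Ioo p q, (F x)⁻¹ := by
    refine setLIntegral_congr_fun measurableSet_Ioo fun x hx => ?_
    have hpos := pos_of_accumulates hφ ((mem_xCoordinates_iff hφ hPQ).1 (hX hx)).1
    have hxU : x ∈ U := mem_of_indicator_ne_zero hpos.ne'
    simp only [hFdef, indicator_of_mem hxU]
  have hmod : curveModulus (verticalSegments Γ) = ∫⁻ x in Ioo p q, (F x)⁻¹ := by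
    refine le_antisymm (curveModulus_verticalSegments_le hφ hPQ hF.measurable harea hXZ) ?_
    have := lintegral_inv_le_curveModulus one_pos hvert
    rwa [ENNReal.ofReal_one, one_mul] at this
  have hfin : curveModulus (verticalSegments Γ) < ∞ :=
    (curveModulus_mono fun γ hγ => hγ.1).trans_lt (curveModulus_connectingCurves_lt_top hφ hPQ)
  refine ⟨p, q, hpq, hX, hXZ, hmod.trans hfF.symm, hfin, ?_⟩
  have hI : ∫⁻ x in Ioo p q, (F x)⁻¹ ≠ ∞ := by rw [← hmod]; exact hfin.ne
  rw [hmod]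
  -- The lower bound holds for every `ε > 0`; only the upper bound needs `ε` to be small.
  refine tendsto_order.2 ⟨fun m hm => ?_, fun m hm => ?_⟩
  · filter_upwards [self_mem_nhdsWithin] with ε hε
    refine hm.trans_le (lintegral_inv_le_curveModulus hε fun x hx => ?_)
    exact ⟨_, (hvert x hx).1, PlaneCurve.map_verticalScaling_vertical x ε (F x)⟩
  · obtain ⟨η, hη, hlt⟩ := ENNReal.lt_iff_exists_add_pos_lt.1 hm
    filter_upwards [eventually_mul_curveModulus_le hφ hPQ hF harea hX hZ hI (η := η)
      (by exact_mod_cast hη.ne') ENNReal.coe_ne_top] with ε hε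
    exact hε.trans_lt hlt
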